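/- Let $n\ge 2$ and let $\mathfrak g_n=\mathfrak n_-\oplus\mathfrak h\oplus\mathfrak n_+$ be the simple complex Lie algebra of type $B_n$, with positive roots $e_i$ $(1\le i\le n)$ and $e_i\pm e_j$ $(1\le i<j\le n)$. Let $\tilde{\mathfrak g}_n=(\mathfrak g_n\otimes\mathbb C[t,t^{-1}])\oplus\mathbb Cc\oplus\mathbb Cd$ be the corresponding untwisted affine Lie algebra, where $c$ is central, $[d,x\otimes t^m]=m\,x\otimes t^m$, and $[x\otimes t^m,y\otimes t^k]=[x,y]\otimes t^{m+k}+m\,\delta_{m+k,0}(x|y)\,c$ with $(\cdot|\cdot)$ the Killing form of $\mathfrak g_n$. Put $\tilde{\mathfrak h}=(\mathfrak h\otimes 1)\oplus\mathbb Cc\oplus\mathbb Cd$, $\tilde{\mathfrak n}_+=(\mathfrak n_+\otimes 1)\oplus(\mathfrak g_n\otimes t\,\mathbb C[t])$ and $\tilde{\mathfrak b}_n=\tilde{\mathfrak h}\oplus\tilde{\mathfrak n}_+$ (the Borel subalgebra). For $\alpha\in\tilde{\mathfrak h}^*$ let $\tilde{\mathfrak g}_\alpha=\{x\in\tilde{\mathfrak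 g}_n : [h,x]=\alpha(h)x \text{ for all } h\in\tilde{\mathfrak h}\}$; a positive root is a nonzero $\alpha$ with $0\ne\tilde{\mathfrak g}_\alpha\subseteq\tilde{\mathfrak n}_+$. Let $\delta\in\tilde{\mathfrak h}^*$ be given by $\delta(d)=1$, $\delta(c)=0$, $\delta|_{\mathfrak h\otimes 1}=0$, regard the roots of $\mathfrak g_n$ as elements of $\tilde{\mathfrak h}^*$ vanishing on $c$ and $d$, and let $D$ be the set consisting of $\delta$, of the positive roots $\gamma$ of $\mathfrak g_n$, and of the roots $\delta-\gamma$ with $\gamma$ a positive root of $\mathfrak g_n$. A basic ideal is an ideal $\mathfrak i$ of $\tilde{\mathfrak b}_n$ that is contained in $\tilde{\mathfrak n}_+$, has finite codimension, satisfies $\mathfrak i\cap\tilde{\mathfrak g}_\alpha\in\{0,\tilde{\mathfrak g}_\alpha\}$ for every positive root $\alpha$, and contains $\tilde{\mathfrak g}_\alpha$ for at least one $\alpha\in D$. Then there are only finitely many basic ideals, and their number $\tilde b_n$ is given by $$\tilde b_n=(3n+5)\,2^{2n-2}-2(3n-1)\binom{2n-2}{n-1}.$$ -/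

import Mathlib

open LieAlgebra

attribute [local instance 100] LieRing.ofAssociativeRing

noncomputable section

/-! ### The untwisted affine Lie algebra of a complex Lie algebra -/

/-- The untwisted affine Lie algebra `(𝔤 ⊗ ℂ[t,t⁻¹]) ⊕ ℂ c ⊕ ℂ d` attached to a complex Lie algebra
`𝔤`. An element is written as a loop together with its coefficients at `c` and at `d`. -/
@[ext]
structure UntwistedAffine (𝔤 : Type*) [LieRing 𝔤] [LieAlgebra ℂ 𝔤] where
  loop : loopAlgebra ℂ ℤ 𝔤
  central : ℂ
  deg : ℂ

namespace UntwistedAffine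

variable {𝔤 : Type*} [LieRing 𝔤] [LieAlgebra ℂ 𝔤]

/-- The loop `x ⊗ t ^ m`. -/
def loopMonomial (m : ℤ) (x : 𝔤) : loopAlgebra ℂ ℤ 𝔤 :=
  (LoopAlgebra.toFinsupp ℂ ℤ 𝔤).symm (Finsupp.single m x)

/-- The degree derivation `t · d/dt` of the loop algebra: `x ⊗ t ^ m ↦ m (x ⊗ t ^ m)`. -/
def loopDeriv : loopAlgebra ℂ ℤ 𝔤 →ₗ[ℂ] loopAlgebra ℂ ℤ 𝔤 :=
  (LoopAlgebra.toFinsupp ℂ ℤ 𝔤).symm.toLinearMap ∘ₗ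
    (Finsupp.lsum ℂ fun m : ℤ => (m : ℂ) • Finsupp.lsingle m) ∘ₗ
      (LoopAlgebra.toFinsupp ℂ ℤ 𝔤).toLinearMap

/-- The central cocycle: `(x ⊗ t ^ m, y ⊗ t ^ k) ↦ m (x | y) δ_{m + k, 0}`, where `( · | · )` is the
Killing form. -/
def loopCocycle : loopAlgebra ℂ ℤ 𝔤 →ₗ[ℂ] loopAlgebra ℂ ℤ 𝔤 →ₗ[ℂ] ℂ :=
  (LoopAlgebra.residuePairing ℂ ℤ 𝔤 (killingForm ℂ 𝔤)).flip

lemma loop_ext {M : Type*} [AddCommGroup M] [Module ℂ M] {f g : loopAlgebra ℂ ℤ 𝔤 →ₗ[ℂ] M}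
    (h : ∀ m x, f (loopMonomial m x) = g (loopMonomial m x)) : f = g := by
  ext1
  ext m x
  have := h m x
  simpa [loopMonomial] using this

lemma loopDeriv_monomial (m : ℤ) (x : 𝔤) :
    loopDeriv (loopMonomial m x) = (m : ℂ) • loopMonomial m x := by
  have h : loopDeriv (loopMonomial m x) = (LoopAlgebra.toFinsupp ℂ ℤ 𝔤).symm
      (Finsupp.lsum ℂ (fun m : ℤ => (m : ℂ) • Finsupp.lsingle m)
        (LoopAlgebra.toFinsupp ℂ ℤ 𝔤 ((LoopAlgebra.toFinsupp ℂ ℤ 𝔤).symm (Finsupp.single m x)))) := rfl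
  rw [h, LinearEquiv.apply_symm_apply, Finsupp.lsum_single, LinearMap.smul_apply,
    Finsupp.lsingle_apply, map_smul]
  rfl

lemma loopCocycle_apply (f g : loopAlgebra ℂ ℤ 𝔤) :
    loopCocycle f g = LoopAlgebra.residuePairing ℂ ℤ 𝔤 (killingForm ℂ 𝔤) g f := rfl

lemma loopCocycle_monomial (m k : ℤ) (x y : 𝔤) :
    loopCocycle (loopMonomial m x) (loopMonomial k y) =
      if m + k = 0 then (m : ℂ) * killingForm ℂ 𝔤 x y else 0 := by
  rw [loopCocycle_apply, LoopAlgebra.residuePairing_apply_apply, loopMonomial, loopMonomial,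
    LinearEquiv.apply_symm_apply, LinearEquiv.apply_symm_apply, Finsupp.sum_single_index (by simp), Finsupp.single_apply]
  by_cases h : m + k = 0
  · rw [if_pos (by grind), if_pos h, LieModule.traceForm_comm, zsmul_eq_mul]
  · rw [if_neg (by grind), if_neg h]
    simp

lemma lie_monomial (m k : ℤ) (x y : 𝔤) :
    ⁅loopMonomial m x, loopMonomial k y⁆ = loopMonomial (m + k) ⁅x, y⁆ := by
  simp only [loopMonomial, LoopAlgebra.toFinsupp_symm_single]
  rw [LieAlgebra.ExtendScalars.bracket_tmul, AddMonoidAlgebra.single_mul_single, one_mul]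

lemma loopDeriv_lie (f g : loopAlgebra ℂ ℤ 𝔤) :
    loopDeriv ⁅f, g⁆ = ⁅loopDeriv f, g⁆ + ⁅f, loopDeriv g⁆ := by
  have key : (LieModule.toEnd ℂ (loopAlgebra ℂ ℤ 𝔤) (loopAlgebra ℂ ℤ 𝔤)).toLinearMap.compr₂
      loopDeriv =
      (LieModule.toEnd ℂ (loopAlgebra ℂ ℤ 𝔤) (loopAlgebra ℂ ℤ 𝔤)).toLinearMap ∘ₗ loopDeriv +
      (LieModule.toEnd ℂ (loopAlgebra ℂ ℤ 𝔤) (loopAlgebra ℂ ℤ 𝔤)).toLinearMap.compl₂ loopDeriv := by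
    refine loop_ext fun m x => loop_ext fun k y => ?_
    simp [loopDeriv_monomial, lie_monomial, add_smul]
  simpa using LinearMap.congr_fun₂ key f g

lemma loopCocycle_self (f : loopAlgebra ℂ ℤ 𝔤) : loopCocycle f f = 0 :=
  (TrivialLieModule.equiv ℂ (loopAlgebra ℂ ℤ 𝔤) ℂ).symm.map_eq_zero_iff.mp <|
    LieModule.Cohomology.mem_twoCochain_iff.mp (LoopAlgebra.twoCochainOfBilinear ℂ ℤ 𝔤
      (killingForm ℂ 𝔤) ⟨LieModule.traceForm_comm ℂ 𝔤 𝔤⟩).2 f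

lemma loopCocycle_lie (f g h : loopAlgebra ℂ ℤ 𝔤) :
    loopCocycle f ⁅g, h⁆ = loopCocycle ⁅f, g⁆ h + loopCocycle g ⁅f, h⁆ := by
  have hs : ∀ f g : loopAlgebra ℂ ℤ 𝔤,
      LoopAlgebra.residuePairing ℂ ℤ 𝔤 (killingForm ℂ 𝔤) f g = - loopCocycle f g := by
    intro f g
    have h := loopCocycle_self (f + g)
    simp only [map_add, LinearMap.add_apply, loopCocycle_self] at h
    rw [← loopCocycle_apply]
    linear_combination h
  have key := (LieModule.Cohomology.mem_twoCocycle_iff_of_trivial _ _ _ _).mp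
    (LoopAlgebra.twoCocycleOfBilinear ℂ ℤ 𝔤 (killingForm ℂ 𝔤)
      (LieModule.traceForm_lieInvariant ℂ 𝔤 𝔤) ⟨LieModule.traceForm_comm ℂ 𝔤 𝔤⟩).2 f g h
  have key' : LoopAlgebra.residuePairing ℂ ℤ 𝔤 (killingForm ℂ 𝔤) f ⁅g, h⁆ =
      LoopAlgebra.residuePairing ℂ ℤ 𝔤 (killingForm ℂ 𝔤) ⁅f, g⁆ h +
      LoopAlgebra.residuePairing ℂ ℤ 𝔤 (killingForm ℂ 𝔤) g ⁅f, h⁆ := key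
  simp only [hs] at key'
  linear_combination -key'

lemma loopCocycle_deriv (f g : loopAlgebra ℂ ℤ 𝔤) :
    loopCocycle (loopDeriv f) g + loopCocycle f (loopDeriv g) = 0 := by
  have key : loopCocycle ∘ₗ loopDeriv + loopCocycle.compl₂ loopDeriv =
      (0 : loopAlgebra ℂ ℤ 𝔤 →ₗ[ℂ] loopAlgebra ℂ ℤ 𝔤 →ₗ[ℂ] ℂ) := by
    refine loop_ext fun m x => loop_ext fun k y => ?_
    by_cases h : m + k = 0
    · obtain rfl : k = -m := by grind
      simp [loopDeriv_monomial, loopCocycle_monomial]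
    · simp [loopDeriv_monomial, loopCocycle_monomial, h]
  simpa using LinearMap.congr_fun₂ key f g

section Axioms

variable {L : Type*} [LieRing L] [LieAlgebra ℂ L] (D : L →ₗ[ℂ] L) (ω : L →ₗ[ℂ] L →ₗ[ℂ] ℂ)

lemma aux_add_lie (f g h : L) (a b e : ℂ) :
    ⁅f + g, h⁆ + (a + b) • D h - e • D (f + g) =
      (⁅f, h⁆ + a • D h - e • D f) + (⁅g, h⁆ + b • D h - e • D g) := by
  simp only [add_lie, add_smul, map_add, smul_add]
  abel

lemma aux_lie_add (f g h : L) (a b e : ℂ) :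
    ⁅f, g + h⁆ + a • D (g + h) - (b + e) • D f =
      (⁅f, g⁆ + a • D g - b • D f) + (⁅f, h⁆ + a • D h - e • D f) := by
  simp only [lie_add, add_smul, map_add, smul_add]
  abel

lemma aux_lie_smul (r : ℂ) (f g : L) (a b : ℂ) :
    ⁅f, r • g⁆ + a • D (r • g) - (r • b) • D f = r • (⁅f, g⁆ + a • D g - b • D f) := by
  simp only [lie_smul, map_smul, smul_add, smul_sub, smul_eq_mul, mul_smul, smul_comm r a]

lemma aux_leibniz (hD : ∀ f g, D ⁅f, g⁆ = ⁅D f, g⁆ + ⁅f, D g⁆) (f g h : L) (a b e : ℂ) :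
    ⁅f, ⁅g, h⁆ + b • D h - e • D g⁆ + a • D (⁅g, h⁆ + b • D h - e • D g) - (0 : ℂ) • D f =
      (⁅⁅f, g⁆ + a • D g - b • D f, h⁆ + (0 : ℂ) • D h - e • D (⁅f, g⁆ + a • D g - b • D f)) +
      (⁅g, ⁅f, h⁆ + a • D h - e • D f⁆ + b • D (⁅f, h⁆ + a • D h - e • D f) - (0 : ℂ) • D g) := by
  simp only [lie_add, lie_sub, add_lie, sub_lie, lie_smul, smul_lie, map_add, map_sub, map_smul, hD,
    smul_add, smul_sub, zero_smul, leibniz_lie f g h, smul_comm a b, smul_comm a e, smul_comm b e,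
    ← lie_skew (D f) g]
  simp only [smul_neg]
  abel

lemma aux_cocycle (hω : ∀ f g h, ω f ⁅g, h⁆ = ω ⁅f, g⁆ h + ω g ⁅f, h⁆)
    (hωs : ∀ f, ω f f = 0) (hDω : ∀ f g, ω (D f) g + ω f (D g) = 0)
    (f g h : L) (a b e : ℂ) :
    ω f (⁅g, h⁆ + b • D h - e • D g) =
      ω (⁅f, g⁆ + a • D g - b • D f) h + ω g (⁅f, h⁆ + a • D h - e • D f) := by
  have h1 := hDω g h
  have h2 := hDω f h
  have h3 := hDω f g
  have h4 : ω g (D f) = - ω (D f) g := by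
    have := hωs (g + D f)
    simp only [map_add, LinearMap.add_apply, hωs] at this
    linear_combination this
  simp only [map_add, map_sub, map_smul, LinearMap.add_apply, LinearMap.sub_apply,
    LinearMap.smul_apply, smul_eq_mul, hω f g h, h4]
  linear_combination b * h2 - a * h1 - e * h3

end Axioms

/-- The underlying vector space is a direct sum. -/
def toProd : UntwistedAffine 𝔤 ≃ loopAlgebra ℂ ℤ 𝔤 × ℂ × ℂ where
  toFun x := ⟨x.loop, x.central, x.deg⟩
  invFun x := ⟨x.1, x.2.1, x.2.2⟩
  left_inv _ := rfl
  right_inv _ := rfl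

instance : AddCommGroup (UntwistedAffine 𝔤) := toProd.addCommGroup

instance : Module ℂ (UntwistedAffine 𝔤) := toProd.module ℂ

/-- `⁅f + λ c + a d, g + μ c + b d⁆ = ⁅f, g⁆ + a (t g') - b (t f') + ω(f, g) c`, with `ω` the central
cocycle; `c` is central and `⁅d, x ⊗ t ^ m⁆ = m (x ⊗ t ^ m)`. -/
instance : Bracket (UntwistedAffine 𝔤) (UntwistedAffine 𝔤) where
  bracket x y :=
    ⟨⁅x.loop, y.loop⁆ + x.deg • loopDeriv y.loop - y.deg • loopDeriv x.loop,
      loopCocycle x.loop y.loop, 0⟩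

lemma zero_eq_mk : (0 : UntwistedAffine 𝔤) = ⟨0, 0, 0⟩ := rfl

lemma add_eq_mk (x y : UntwistedAffine 𝔤) :
    x + y = ⟨x.loop + y.loop, x.central + y.central, x.deg + y.deg⟩ := rfl

lemma smul_eq_mk (a : ℂ) (x : UntwistedAffine 𝔤) :
    a • x = ⟨a • x.loop, a • x.central, a • x.deg⟩ := rfl

lemma lie_eq_mk (x y : UntwistedAffine 𝔤) :
    ⁅x, y⁆ = ⟨⁅x.loop, y.loop⁆ + x.deg • loopDeriv y.loop - y.deg • loopDeriv x.loop,
      loopCocycle x.loop y.loop, 0⟩ := rfl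

instance : LieRing (UntwistedAffine 𝔤) where
  add_lie _ _ _ := UntwistedAffine.ext (aux_add_lie _ _ _ _ _ _ _)
    (by rw [lie_eq_mk]; exact LinearMap.map_add₂ _ _ _ _) (add_zero _).symm
  lie_add x _ _ := UntwistedAffine.ext (aux_lie_add _ _ _ _ _ _ _)
    (map_add (loopCocycle x.loop) _ _) (add_zero _).symm
  lie_self x := UntwistedAffine.ext (by simp [lie_eq_mk, zero_eq_mk]) (loopCocycle_self _) rfl
  leibniz_lie _ _ _ := UntwistedAffine.ext (aux_leibniz _ loopDeriv_lie _ _ _ _ _ _)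
    (aux_cocycle _ _ loopCocycle_lie loopCocycle_self loopCocycle_deriv _ _ _ _ _ _)
    (add_zero _).symm

instance : LieAlgebra ℂ (UntwistedAffine 𝔤) where
  lie_smul _ x _ := UntwistedAffine.ext (aux_lie_smul _ _ _ _ _ _)
    (map_smul (loopCocycle x.loop) _ _) (smul_zero _).symm

/-- The element `x ⊗ t ^ m`. -/
def monomial (m : ℤ) (x : 𝔤) : UntwistedAffine 𝔤 := ⟨loopMonomial m x, 0, 0⟩

/-- The central element. -/
def c : UntwistedAffine 𝔤 := ⟨0, 1, 0⟩

/-- The degree derivation. -/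
def d : UntwistedAffine 𝔤 := ⟨0, 0, 1⟩

lemma lie_c (x : UntwistedAffine 𝔤) : ⁅x, (c : UntwistedAffine 𝔤)⁆ = 0 :=
  UntwistedAffine.ext (by simp [lie_eq_mk, zero_eq_mk, c]; exact @lie_zero (loopAlgebra ℂ ℤ 𝔤) (loopAlgebra ℂ ℤ 𝔤) _ _ _ _)
    (by simp [lie_eq_mk, zero_eq_mk, c]) rfl

lemma d_lie_monomial (m : ℤ) (x : 𝔤) :
    ⁅(d : UntwistedAffine 𝔤), monomial m x⁆ = (m : ℂ) • monomial m x :=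
  UntwistedAffine.ext
    (by simp [lie_eq_mk, smul_eq_mk, d, monomial, loopDeriv_monomial]; exact @zero_lie (loopAlgebra ℂ ℤ 𝔤) (loopAlgebra ℂ ℤ 𝔤) _ _ _ _)
    (by simp [lie_eq_mk, smul_eq_mk, d, monomial]) (smul_zero _).symm

lemma monomial_lie_monomial (m k : ℤ) (x y : 𝔤) :
    ⁅monomial m x, monomial k y⁆ =
      monomial (m + k) ⁅x, y⁆ + (if m + k = 0 then (m : ℂ) * killingForm ℂ 𝔤 x y else 0) • c := by
  rw [← loopCocycle_monomial]
  exact UntwistedAffine.ext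
    (by simp [lie_eq_mk, add_eq_mk, smul_eq_mk, c, monomial, lie_monomial])
    (by simp [lie_eq_mk, add_eq_mk, smul_eq_mk, c, monomial])
    (by simp [lie_eq_mk, add_eq_mk, smul_eq_mk, c, monomial])

end UntwistedAffine

/-! ### Type `B` -/

namespace TypeB

open UntwistedAffine

/-- The simple Lie algebra of type `B_n`: complex matrices of size `2n + 1` that are skew-adjoint for
the symmetric form with matrix `JB`, in a basis `u_0`, `u_1, …, u_n`, `u_{-1}, …, u_{-n}`. -/
abbrev SoB (n : ℕ) : LieSubalgebra ℂ (Matrix (Unit ⊕ Fin n ⊕ Fin n) (Unit ⊕ Fin n ⊕ Fin n) ℂ) :=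
  Orthogonal.typeB (Fin n) ℂ

/-- The order `u_1, …, u_n, u_0, u_{-n}, …, u_{-1}` of the basis in which the positive root vectors
are upper triangular. -/
def basisPos {n : ℕ} : Unit ⊕ Fin n ⊕ Fin n → ℕ
  | Sum.inl _ => n
  | Sum.inr (Sum.inl i) => i
  | Sum.inr (Sum.inr i) => 2 * n - i

/-- The Cartan subalgebra `𝔥`: diagonal matrices. -/
def finCartan (n : ℕ) : Submodule ℂ (SoB n) where
  carrier := {A | ∀ p q, p ≠ q → A.1 p q = 0}
  add_mem' hA hB p q h := by simp [hA p q h, hB p q h]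
  zero_mem' p q _ := rfl
  smul_mem' a A hA p q h := by simp [hA p q h]

/-- The nilpotent subalgebra `𝔫₊`: strictly upper triangular matrices for the order `basisPos`. -/
def finNilPlus (n : ℕ) : Submodule ℂ (SoB n) where
  carrier := {A | ∀ p q, basisPos q ≤ basisPos p → A.1 p q = 0}
  add_mem' hA hB p q h := by simp [hA p q h, hB p q h]
  zero_mem' p q _ := rfl
  smul_mem' a A hA p q h := by simp [hA p q h]

lemma coe_lie_apply {n : ℕ} (A B : SoB n) (p q : Unit ⊕ Fin n ⊕ Fin n) :
    (⁅A, B⁆ : SoB n).1 p q = ∑ r, A.1 p r * B.1 r q - ∑ r, B.1 p r * A.1 r q := by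
  rw [LieSubalgebra.coe_bracket, Ring.lie_def]
  simp [Matrix.mul_apply]

lemma lie_finCartan {n : ℕ} {A B : SoB n} (hA : A ∈ finCartan n) (hB : B ∈ finCartan n) :
    ⁅A, B⁆ = 0 := by
  apply Subtype.ext
  ext p q
  rw [coe_lie_apply, Finset.sum_eq_single p, Finset.sum_eq_single q]
  · by_cases h : p = q
    · subst h; simp [mul_comm]
    · simp [hB p q h]
  · intro r _ hr; simp [hA r q hr]
  · simp
  · intro r _ hr; simp [hA p r hr.symm]
  · simp

lemma lie_mem_finNilPlus_of_cartan {n : ℕ} {A B : SoB n} (hA : A ∈ finCartan n)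
    (hB : B ∈ finNilPlus n) : ⁅A, B⁆ ∈ finNilPlus n := by
  intro p q h
  rw [coe_lie_apply, Finset.sum_eq_single p, Finset.sum_eq_single q]
  · simp [hB p q h]
  · intro r _ hr; simp [hA r q hr]
  · simp
  · intro r _ hr; simp [hA p r hr.symm]
  · simp

lemma lie_mem_finNilPlus {n : ℕ} {A B : SoB n} (hA : A ∈ finNilPlus n) (hB : B ∈ finNilPlus n) :
    ⁅A, B⁆ ∈ finNilPlus n := by
  intro p q h
  rw [coe_lie_apply, Finset.sum_eq_zero, Finset.sum_eq_zero, sub_zero]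
  all_goals
    intro r _
    rcases le_total (basisPos r) (basisPos p) with hr | hr
    · simp [hA p r hr, hB p r hr]
    · simp [hA r q (h.trans hr), hB r q (h.trans hr)]

/-- The untwisted affine Lie algebra of type `B̃_n`. -/
abbrev AffineB (n : ℕ) := UntwistedAffine (SoB n)

/-- `𝔥̃ = Span ({c, d} ∪ {h ⊗ 1 | h ∈ 𝔥})`. -/
def affineCartan (n : ℕ) : Submodule ℂ (AffineB n) :=
  Submodule.span ℂ ({c, d} ∪ {y | ∃ h ∈ finCartan n, y = monomial 0 h})

/-- `𝔫̃₊ = Span ({x ⊗ 1 | x ∈ 𝔫₊} ∪ {x ⊗ t ^ k | x ∈ 𝔤, k > 0})`. -/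
def affineNilPlus (n : ℕ) : Submodule ℂ (AffineB n) :=
  Submodule.span ℂ ({y | ∃ x ∈ finNilPlus n, y = monomial 0 x} ∪
    {y | ∃ (k : ℤ) (x : SoB n), 0 < k ∧ y = monomial k x})

/-- `𝔟̃ = 𝔥̃ ⊕ 𝔫̃₊` is closed under the bracket. -/
lemma lie_mem_borel (n : ℕ) {x y : AffineB n} (hx : x ∈ affineCartan n ⊔ affineNilPlus n)
    (hy : y ∈ affineCartan n ⊔ affineNilPlus n) : ⁅x, y⁆ ∈ affineCartan n ⊔ affineNilPlus n := by
  have mH : ∀ h ∈ finCartan n, monomial 0 h ∈ affineCartan n ⊔ affineNilPlus n := fun h hh =>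
    Submodule.mem_sup_left (Submodule.subset_span (Or.inr ⟨h, hh, rfl⟩))
  have mN : ∀ h ∈ finNilPlus n, monomial 0 h ∈ affineCartan n ⊔ affineNilPlus n := fun h hh =>
    Submodule.mem_sup_right (Submodule.subset_span (Or.inl ⟨h, hh, rfl⟩))
  have mP : ∀ (k : ℤ) (x : SoB n), 0 < k → monomial k x ∈ affineCartan n ⊔ affineNilPlus n :=
    fun k x hk =>
    Submodule.mem_sup_right (Submodule.subset_span (Or.inr ⟨k, x, hk, rfl⟩))
  have lie_d : ∀ (m : ℤ) (x : SoB n), monomial m x ∈ affineCartan n ⊔ affineNilPlus n →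
      ⁅monomial m x, (d : AffineB n)⁆ ∈ affineCartan n ⊔ affineNilPlus n := fun m x hx => by
    rw [← lie_skew, d_lie_monomial]
    exact neg_mem (Submodule.smul_mem _ _ hx)
  have lie_m : ∀ (m k : ℤ) (x y : SoB n), 0 ≤ m → 0 ≤ k →
      monomial (m + k) ⁅x, y⁆ ∈ affineCartan n ⊔ affineNilPlus n →
      ⁅monomial m x, monomial k y⁆ ∈ affineCartan n ⊔ affineNilPlus n := fun m k x y hm hk h => by
    have h0 : (if m + k = 0 then (m : ℂ) * killingForm ℂ (SoB n) x y else 0) = 0 := by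
      split_ifs with hmk
      · obtain rfl : m = 0 := by lia
        simp
      · rfl
    rwa [monomial_lie_monomial, h0, zero_smul, add_zero]
  rw [affineCartan, affineNilPlus, ← Submodule.span_union] at hx hy
  induction hx using Submodule.span_induction with
  | zero => rw [zero_lie]; exact zero_mem _
  | add x x' _ _ h h' => rw [add_lie]; exact add_mem h h'
  | smul a x _ h => rw [smul_lie]; exact Submodule.smul_mem _ _ h
  | mem x hx =>
    induction hy using Submodule.span_induction with
    | zero => rw [lie_zero]; exact zero_mem _
    | add y y' _ _ h h' => rw [lie_add]; exact add_mem h h'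
    | smul a y _ h => rw [lie_smul]; exact Submodule.smul_mem _ _ h
    | mem y hy =>
      rcases hy with ((rfl | rfl) | ⟨B, hB, rfl⟩) | (⟨B, hB, rfl⟩ | ⟨k, B, hk, rfl⟩)
      · rw [lie_c]; exact zero_mem _
      · rcases hx with ((rfl | rfl) | ⟨A, hA, rfl⟩) | (⟨A, hA, rfl⟩ | ⟨m, A, hm, rfl⟩)
        · rw [← lie_skew, lie_c, neg_zero]; exact zero_mem _
        · rw [lie_self]; exact zero_mem _
        · exact lie_d _ _ (mH _ hA)
        · exact lie_d _ _ (mN _ hA)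
        · exact lie_d _ _ (mP _ _ hm)
      · rcases hx with ((rfl | rfl) | ⟨A, hA, rfl⟩) | (⟨A, hA, rfl⟩ | ⟨m, A, hm, rfl⟩)
        · rw [← lie_skew, lie_c, neg_zero]; exact zero_mem _
        · rw [d_lie_monomial]; exact Submodule.smul_mem _ _ (mH _ hB)
        · refine lie_m _ _ _ _ le_rfl le_rfl ?_
          rw [lie_finCartan hA hB]; exact mH _ (zero_mem _)
        · refine lie_m _ _ _ _ le_rfl le_rfl (mN _ ?_)
          rw [← lie_skew]; exact neg_mem (lie_mem_finNilPlus_of_cartan hB hA)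
        · exact lie_m _ _ _ _ hm.le le_rfl (mP _ _ (by lia))
      · rcases hx with ((rfl | rfl) | ⟨A, hA, rfl⟩) | (⟨A, hA, rfl⟩ | ⟨m, A, hm, rfl⟩)
        · rw [← lie_skew, lie_c, neg_zero]; exact zero_mem _
        · rw [d_lie_monomial]; exact Submodule.smul_mem _ _ (mN _ hB)
        · exact lie_m _ _ _ _ le_rfl le_rfl (mN _ (lie_mem_finNilPlus_of_cartan hA hB))
        · exact lie_m _ _ _ _ le_rfl le_rfl (mN _ (lie_mem_finNilPlus hA hB))
        · exact lie_m _ _ _ _ hm.le le_rfl (mP _ _ (by lia))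
      · rcases hx with ((rfl | rfl) | ⟨A, hA, rfl⟩) | (⟨A, hA, rfl⟩ | ⟨m, A, hm, rfl⟩)
        · rw [← lie_skew, lie_c, neg_zero]; exact zero_mem _
        · rw [d_lie_monomial]; exact Submodule.smul_mem _ _ (mP _ _ hk)
        · exact lie_m _ _ _ _ le_rfl hk.le (mP _ _ (by lia))
        · exact lie_m _ _ _ _ le_rfl hk.le (mP _ _ (by lia))
        · exact lie_m _ _ _ _ hm.le hk.le (mP _ _ (by lia))

/-- The Borel subalgebra `𝔟̃ = 𝔥̃ ⊕ 𝔫̃₊`. -/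
def affineBorel (n : ℕ) : LieSubalgebra ℂ (AffineB n) where
  toSubmodule := affineCartan n ⊔ affineNilPlus n
  lie_mem' := lie_mem_borel n

/-- The root space `{x | ⁅h, x⁆ = α(h) x for all h ∈ 𝔥̃}` of `α ∈ 𝔥̃*`. -/
def affineRootSpace (n : ℕ) (α : Module.Dual ℂ (affineCartan n)) : Submodule ℂ (AffineB n) where
  carrier := {x | ∀ h : affineCartan n, ⁅(h : AffineB n), x⁆ = α h • x}
  add_mem' hx hy h := by rw [lie_add, hx h, hy h, smul_add]
  zero_mem' h := by rw [lie_zero, smul_zero]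
  smul_mem' a x hx h := by rw [lie_smul, hx h, smul_comm]

/-- A positive root: a nonzero `α ∈ 𝔥̃*` whose root space is nonzero and lies in `𝔫̃₊`. -/
def IsPosRoot (n : ℕ) (α : Module.Dual ℂ (affineCartan n)) : Prop :=
  α ≠ 0 ∧ affineRootSpace n α ≠ ⊥ ∧ affineRootSpace n α ≤ affineNilPlus n

/-- The functional `e_i`, which takes the `i`-th diagonal entry of the part in `𝔥 ⊗ 1` and vanishes
on `c` and `d`. -/
def eps (n : ℕ) (i : Fin n) : Module.Dual ℂ (affineCartan n) where
  toFun h := (LoopAlgebra.toFinsupp ℂ ℤ (SoB n) h.1.loop 0).1 (Sum.inr (Sum.inl i))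
    (Sum.inr (Sum.inl i))
  map_add' x y := by simp [add_eq_mk]
  map_smul' a x := by simp [smul_eq_mk]

/-- The indivisible positive imaginary root `δ`: it takes the coefficient at `d`. -/
def delta (n : ℕ) : Module.Dual ℂ (affineCartan n) where
  toFun h := h.1.deg
  map_add' _ _ := rfl
  map_smul' _ _ := rfl

/-- The positive roots of `B_n`: `e_i`, and `e_i - e_j`, `e_i + e_j` for `i < j`. -/
def finPosRoots (n : ℕ) : Set (Module.Dual ℂ (affineCartan n)) :=
  {γ | (∃ i, γ = eps n i) ∨
    ∃ i j, i < j ∧ (γ = eps n i - eps n j ∨ γ = eps n i + eps n j)}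

/-- The set `D` consisting of `δ`, of the positive roots of `B_n`, and of the roots `δ + γ` with `γ`
a negative root of `B_n`. -/
def fundamentalRoots (n : ℕ) : Set (Module.Dual ℂ (affineCartan n)) :=
  {delta n} ∪ finPosRoots n ∪ {β | ∃ γ ∈ finPosRoots n, β = delta n - γ}

/-- An ideal of `𝔟̃`, as a subspace of the affine Lie algebra. -/
def ambient {n : ℕ} (I : LieIdeal ℂ (affineBorel n)) : Submodule ℂ (AffineB n) :=
  I.toSubmodule.map (affineBorel n).toSubmodule.subtype

/-- A combinatorial ideal: an ideal of `𝔟̃` contained in `𝔫̃₊`, of finite codimension, which meets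
the root space of each positive root in `0` or in the whole root space. -/
def IsCombinatorialIdeal {n : ℕ} (I : LieIdeal ℂ (affineBorel n)) : Prop :=
  ambient I ≤ affineNilPlus n ∧
  FiniteDimensional ℂ (affineBorel n ⧸ I.toSubmodule) ∧
  ∀ α, IsPosRoot n α →
    ambient I ⊓ affineRootSpace n α = ⊥ ∨ ambient I ⊓ affineRootSpace n α = affineRootSpace n α

/-- The support: the set of positive roots whose root spaces are contained in the ideal. -/
def idealSupport {n : ℕ} (I : LieIdeal ℂ (affineBorel n)) : Set (Module.Dual ℂ (affineCartan n)) :=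
  {α | IsPosRoot n α ∧ affineRootSpace n α ≤ ambient I}

/-- A basic ideal: a combinatorial ideal whose support meets `D`. -/
def IsBasicIdeal {n : ℕ} (I : LieIdeal ℂ (affineBorel n)) : Prop :=
  IsCombinatorialIdeal I ∧ (idealSupport I ∩ fundamentalRoots n).Nonempty

end TypeB

end

/-!
For a positive root `γ` of `B_n`, bracketing the root spaces of `γ` and `δ - γ` gives a nonzero
element of `𝔥 ⊗ t`, so a basic ideal contains the root space of `δ`. Bracketing that root space
further shows that it contains all root spaces of degree at least two and those of the `δ + γ`. It
is thus determined by the set `A` of positive roots `γ` of `B_n` in its support and the set `C` of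
those `γ` for which `δ - γ` is not in its support. Both are upper sets of the root poset, and the
remaining condition for a pair of upper sets to come from an ideal is that no root of `A` and root
of `C` add up to the highest root.

The positive roots form the triangle of the positions `(i, q)` with `i < q` and `i + q < 2 n` in the
matrices of the orthogonal Lie algebra. Deleting the first row turns an upper set for `B_{n+1}` into
one for `B_n`, which gives a recursion for the number of upper sets with `k` elements in the first
row. The condition on the highest root involves only the first row of each set and the second row
of the other, so the pairs with given first rows are counted by products of these numbers, and the
sum of the products is evaluated by means of tails of binomial sums.
-/

/-! ### Counting and binomial sums -/

lemma encard_biUnion_finset {α ι : Type*} (t : Finset ι) {s : ι → Set α}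
    (hs : (t : Set ι).PairwiseDisjoint s) : (⋃ i ∈ t, s i).encard = ∑ i ∈ t, (s i).encard := by
  rw [← finsum_mem_coe_finset, ← t.finite_toSet.encard_biUnion hs]
  simp only [Finset.mem_coe]

section BinomialSums

open Finset

lemma sum_range_triangle_comm {R : Type*} [AddCommMonoid R] (N : ℕ) (f : ℕ → ℕ → R) :
    ∑ k ∈ range N, ∑ l ∈ range (N - k), f k l = ∑ k ∈ range N, ∑ l ∈ range (N - k), f l k := by
  refine sum_comm' fun k l => ?_
  simp only [mem_range]
  lia

-- The pairs with `k + l ≤ N` form the first triangle; the others are reflected onto the second one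
-- by `(k, l) ↦ (N - l, N - k)`.
lemma sum_product_min_eq_triangles {R : Type*} [CommSemiring R] (N : ℕ) (F : ℕ → R) :
    ∑ x ∈ range (N + 1) ×ˢ range (N + 1), F (min x.1 (N - x.2)) * F (min x.2 (N - x.1)) =
      ∑ k ∈ range (N + 1), ∑ l ∈ range (N + 1 - k), F k * F l +
      ∑ k ∈ range N, ∑ l ∈ range (N - k), F k * F l := by
  have row : ∀ k ∈ range (N + 1),
      ∑ l ∈ range (N + 1), F (min k (N - l)) * F (min l (N - k)) =
        ∑ l ∈ range (N + 1 - k), F k * F l + ∑ l ∈ range k, F (N - k) * F l := by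
    intro k hk
    rw [mem_range] at hk
    nth_rewrite 1 [show N + 1 = N + 1 - k + k by lia]
    rw [sum_range_add]
    congr 1
    · refine sum_congr rfl fun l hl => ?_
      rw [mem_range] at hl
      rw [min_eq_left (by lia), min_eq_left (by lia)]
    · rw [← sum_range_reflect]
      refine sum_congr rfl fun l hl => ?_
      rw [mem_range] at hl
      rw [min_eq_right (by lia), min_eq_right (by lia), mul_comm]
      congr 2
      lia
  rw [sum_product, sum_congr rfl row, sum_add_distrib]
  congr 1
  rw [← sum_range_reflect, sum_range_succ, show N + 1 - 1 - N = 0 by lia, range_zero, sum_empty,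
    add_zero]
  refine sum_congr rfl fun k hk => ?_
  rw [mem_range] at hk
  rw [show N + 1 - 1 - k = N - k by lia, show N - (N - k) = k by lia]

/-- The sum of the binomial coefficients `C(M, j)` with `j ≥ s`, indexed by `i = j - s`. -/
def chooseTail (M s : ℕ) : ℤ := ∑ i ∈ range (M + 1), (M.choose (s + i) : ℤ)

/-- The sum of `(j - s) C(M, j)` over `j ≥ s`, indexed by `i = j - s`. -/
def chooseMoment (M s : ℕ) : ℤ := ∑ i ∈ range (M + 1), (i : ℤ) * (M.choose (s + i) : ℤ)

lemma choose_add_eq_zero {M s i : ℕ} (h : M < i) : M.choose (s + i) = 0 :=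
  Nat.choose_eq_zero_of_lt (by lia)

lemma choose_succ_add (M s i : ℕ) :
    (M + 1).choose (s + 1 + i) = M.choose (s + i) + M.choose (s + 1 + i) := by
  rw [show s + 1 + i = s + i + 1 by lia, Nat.choose_succ_succ]

lemma chooseTail_eq_zero {M s : ℕ} (h : M < s) : chooseTail M s = 0 :=
  sum_eq_zero fun i _ => by rw [Nat.choose_eq_zero_of_lt (by lia), Nat.cast_zero]

lemma chooseTail_eq_choose_add (M s : ℕ) :
    chooseTail M s = M.choose s + chooseTail M (s + 1) := by
  rw [chooseTail, sum_range_succ', chooseTail, sum_range_succ _ M,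
    Nat.choose_eq_zero_of_lt (show M < s + 1 + M by lia), Nat.cast_zero, add_zero, add_zero,
    add_comm]
  simp only [← add_assoc, add_right_comm]

lemma chooseTail_succ (M s : ℕ) :
    chooseTail (M + 1) (s + 1) = chooseTail M s + chooseTail M (s + 1) := by
  simp only [chooseTail, choose_succ_add, Nat.cast_add, sum_add_distrib, sum_range_succ _ (M + 1),
    choose_add_eq_zero (Nat.lt_succ_self M), Nat.cast_zero, add_zero]

lemma chooseMoment_succ (M s : ℕ) : chooseMoment (M + 1) (s + 1) =
    2 * chooseMoment M (s + 1) + chooseTail M (s + 1) := by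
  have shift : ∑ i ∈ range (M + 1 + 1), (i : ℤ) * M.choose (s + i) =
      chooseMoment M (s + 1) + chooseTail M (s + 1) := by
    rw [sum_range_succ', chooseMoment, chooseTail, ← sum_add_distrib]
    simp only [Nat.cast_zero, zero_mul, add_zero]
    refine sum_congr rfl fun i _ => ?_
    rw [show s + (i + 1) = s + 1 + i by lia]
    push_cast
    ring
  have top : ∑ i ∈ range (M + 1 + 1), (i : ℤ) * M.choose (s + 1 + i) = chooseMoment M (s + 1) := by
    rw [sum_range_succ, choose_add_eq_zero (Nat.lt_succ_self M), Nat.cast_zero, mul_zero, add_zero,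
      chooseMoment]
  simp only [chooseMoment, choose_succ_add, Nat.cast_add, mul_add, sum_add_distrib] at shift top ⊢
  rw [shift, top]
  ring

lemma chooseTail_odd (m : ℕ) : chooseTail (2 * m + 1) (m + 1) = 4 ^ m := by
  have vanish : ∑ i ∈ range (m + 1), (2 * m + 1).choose (m + 1 + (m + 1 + i)) = 0 :=
    sum_eq_zero fun i _ => Nat.choose_eq_zero_of_lt (by lia)
  have reflect : ∑ i ∈ range (m + 1), (2 * m + 1).choose (m + 1 + i) =
      ∑ i ∈ range (m + 1), (2 * m + 1).choose i := by
    rw [← sum_range_reflect]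
    refine sum_congr rfl fun i hi => Nat.choose_symm_of_eq_add ?_
    rw [mem_range] at hi
    lia
  rw [chooseTail, show 2 * m + 1 + 1 = m + 1 + (m + 1) by lia, sum_range_add, ← Nat.cast_sum,
    ← Nat.cast_sum, vanish, reflect, Nat.sum_range_choose_halfway]
  norm_num

lemma two_mul_chooseTail_add_centralBinom (m : ℕ) :
    2 * chooseTail (2 * m) (m + 1) + (2 * m).choose m = 4 ^ m := by
  rw [← chooseTail_odd, chooseTail_succ, chooseTail_eq_choose_add (2 * m) m]
  ring

lemma two_mul_sub_mul_choose (M j : ℕ) :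
    (2 * (j : ℤ) - M) * M.choose j = j * M.choose j - (j + 1) * M.choose (j + 1) := by
  rcases lt_or_ge M j with hj | hj
  · rw [Nat.choose_eq_zero_of_lt hj, Nat.choose_eq_zero_of_lt (by lia)]
    simp
  · have h : (M.choose (j + 1) : ℤ) * (j + 1) = M.choose j * (M - j) := by
      rw [← Nat.cast_sub hj]
      exact_mod_cast Nat.choose_succ_right_eq M j
    linear_combination h

-- The sum of `(2 j - M) C(M, j)` over `j ≥ s` telescopes.
lemma two_mul_chooseMoment (M s : ℕ) :
    2 * chooseMoment M s + (2 * s - M) * chooseTail M s = s * M.choose s := by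
  let g : ℕ → ℤ := fun i => ((s + i : ℕ) : ℤ) * (M.choose (s + i) : ℤ)
  have term : ∀ i ∈ range (M + 1), 2 * ((i : ℤ) * (M.choose (s + i) : ℤ)) +
      (2 * s - M) * (M.choose (s + i) : ℤ) = g i - g (i + 1) := by
    intro i _
    have := two_mul_sub_mul_choose M (s + i)
    simp only [g, ← add_assoc]
    push_cast at this ⊢
    linear_combination this
  rw [chooseMoment, chooseTail, mul_sum, mul_sum, ← sum_add_distrib, sum_congr rfl term,
    sum_range_sub']
  simp only [g, choose_add_eq_zero (Nat.lt_succ_self M), add_zero, Nat.cast_zero, mul_zero,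
    sub_zero]

/-- The sequence `1, 1, 2, 4, 8, …`, whose partial sums are the powers of two. -/
def halfPow (k : ℕ) : ℤ := if k = 0 then 1 else 2 ^ (k - 1)

lemma halfPow_succ (k : ℕ) : halfPow (k + 1) = 2 ^ k := rfl

lemma sum_halfPow (m : ℕ) : ∑ k ∈ range (m + 1), halfPow k = 2 ^ m := by
  induction m with
  | zero => simp [halfPow]
  | succ m ih =>
    rw [sum_range_succ, ih, halfPow_succ]
    ring

lemma sum_triangle_mul_halfPow (M : ℕ) (f : ℕ → ℤ) :
    ∑ k ∈ range (M + 1), ∑ l ∈ range (M + 1 - k), f k * halfPow l =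
      ∑ k ∈ range (M + 1), f k * 2 ^ (M - k) := by
  refine sum_congr rfl fun k hk => ?_
  rw [mem_range] at hk
  rw [← mul_sum, show M + 1 - k = M - k + 1 by lia, sum_halfPow]

lemma two_mul_sum_halfPow_mul_pow (M : ℕ) :
    2 * ∑ k ∈ range (M + 1), halfPow k * 2 ^ (M - k) = (M + 2) * 2 ^ M := by
  induction M with
  | zero => simp [halfPow]
  | succ M ih =>
    have double : ∑ k ∈ range (M + 1), halfPow k * 2 ^ (M + 1 - k) =
        2 * ∑ k ∈ range (M + 1), halfPow k * 2 ^ (M - k) := by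
      rw [mul_sum]
      refine sum_congr rfl fun k hk => ?_
      rw [mem_range] at hk
      rw [show M + 1 - k = M - k + 1 by lia]
      ring
    rw [sum_range_succ, double, ih, halfPow_succ, Nat.sub_self]
    push_cast
    ring

/-- The binomial tail by which the number of upper sets in the root poset of `B_n` with `k` elements
in the first row falls short of `halfPow k`, up to a factor `2`. -/
def upperTail (n k : ℕ) : ℤ := if k = 0 then 0 else chooseTail (k - 1) n

lemma upperTail_succ (n k : ℕ) : upperTail n (k + 1) = chooseTail k n := rfl

lemma upperTail_eq_zero {n k : ℕ} (h : k ≤ n) : upperTail n k = 0 := by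
  rcases k with _ | k
  · rfl
  · exact chooseTail_eq_zero (by lia)

lemma sum_upperTail (n M : ℕ) : ∑ k ∈ range (M + 1), upperTail n k = chooseTail M (n + 1) := by
  induction M with
  | zero => rw [chooseTail_eq_zero (by lia)]; rfl
  | succ M ih => rw [sum_range_succ, ih, upperTail_succ, chooseTail_succ, add_comm]

lemma sum_upperTail_mul_pow (n M : ℕ) :
    ∑ k ∈ range (M + 1), upperTail (n + 1) k * 2 ^ (M - k) = chooseMoment M (n + 1) := by
  induction M with
  | zero => simp [upperTail, chooseMoment]
  | succ M ih =>
    rw [sum_range_succ, chooseMoment_succ, ← ih, mul_sum, upperTail_succ, Nat.sub_self, pow_zero,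
      mul_one]
    congr 1
    refine sum_congr rfl fun k hk => ?_
    rw [mem_range] at hk
    rw [show M + 1 - k = M - k + 1 by lia, pow_succ]
    ring

end BinomialSums

noncomputable section

/-! ### Coefficients of elements of an affine Lie algebra -/

lemma finsupp_sum_eq_sum_of_notMem {ι M N : Type*} [Zero M] [AddCommMonoid N]
    (F : ι →₀ M) (φ : ι → M → N) (h0 : ∀ i, φ i 0 = 0) (s : Finset ι)
    (hs : ∀ i ∉ s, φ i (F i) = 0) : F.sum φ = ∑ i ∈ s, φ i (F i) := by
  classical
  rw [Finsupp.sum_of_support_subset F (s := F.support ∪ s) Finset.subset_union_left φ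
    (fun i _ => h0 i)]
  exact (Finset.sum_subset Finset.subset_union_right fun i _ hi => hs i hi).symm

namespace UntwistedAffine

variable {𝔤 : Type*} [LieRing 𝔤] [LieAlgebra ℂ 𝔤]

/-- The coefficient of an element at `t ^ k`. -/
def coeff (k : ℤ) : UntwistedAffine 𝔤 →ₗ[ℂ] 𝔤 where
  toFun x := LoopAlgebra.toFinsupp ℂ ℤ 𝔤 x.loop k
  map_add' x y := by simp [add_eq_mk]
  map_smul' a x := by simp [smul_eq_mk]

/-- The coefficient at `c`, as a linear functional. -/
def centralₗ : UntwistedAffine 𝔤 →ₗ[ℂ] ℂ where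
  toFun x := x.central
  map_add' _ _ := rfl
  map_smul' _ _ := rfl

/-- The coefficient at `d`, as a linear functional. -/
def degₗ : UntwistedAffine 𝔤 →ₗ[ℂ] ℂ where
  toFun x := x.deg
  map_add' _ _ := rfl
  map_smul' _ _ := rfl

/-- The map `x ↦ x ⊗ t ^ m`, as a linear map. -/
def monomialₗ (m : ℤ) : 𝔤 →ₗ[ℂ] UntwistedAffine 𝔤 where
  toFun x := monomial m x
  map_add' x y := by ext1 <;> simp [monomial, add_eq_mk, loopMonomial]
  map_smul' a x := by ext1 <;> simp [monomial, smul_eq_mk, loopMonomial]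

lemma monomial_smul (m : ℤ) (a : ℂ) (x : 𝔤) : monomial m (a • x) = a • monomial m x :=
  (monomialₗ m).map_smul a x

lemma monomial_zero (m : ℤ) : monomial m (0 : 𝔤) = 0 := (monomialₗ m).map_zero

lemma monomial_sum {ι : Type*} (s : Finset ι) (m : ℤ) (f : ι → 𝔤) :
    monomial m (∑ i ∈ s, f i) = ∑ i ∈ s, monomial m (f i) := map_sum (monomialₗ m) f s

lemma coeff_eq (k : ℤ) (x : UntwistedAffine 𝔤) :
    coeff k x = LoopAlgebra.toFinsupp ℂ ℤ 𝔤 x.loop k := rfl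

lemma coeff_monomial (k m : ℤ) (x : 𝔤) :
    coeff k (monomial m x) = if m = k then x else 0 := by
  simp only [coeff_eq, monomial, loopMonomial, LinearEquiv.apply_symm_apply, Finsupp.single_apply]

lemma coeff_c (k : ℤ) : coeff k (c : UntwistedAffine 𝔤) = 0 := by simp [coeff_eq, c]

lemma coeff_d (k : ℤ) : coeff k (d : UntwistedAffine 𝔤) = 0 := by simp [coeff_eq, d]

lemma ext_coeff {x y : UntwistedAffine 𝔤} (h : ∀ k, coeff k x = coeff k y)
    (hc : x.central = y.central) (hd : x.deg = y.deg) : x = y :=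
  UntwistedAffine.ext ((LoopAlgebra.toFinsupp ℂ ℤ 𝔤).injective (Finsupp.ext h)) hc hd

lemma exists_finset_coeff_eq_zero (x : UntwistedAffine 𝔤) :
    ∃ s : Finset ℤ, ∀ k ∉ s, coeff k x = 0 :=
  ⟨(LoopAlgebra.toFinsupp ℂ ℤ 𝔤 x.loop).support, fun _ hk => Finsupp.notMem_support_iff.mp hk⟩

lemma coeff_sum_monomial (s : Finset ℤ) (f : ℤ → 𝔤) (k : ℤ) :
    coeff k (∑ m ∈ s, monomial m (f m)) = if k ∈ s then f k else 0 := by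
  simp [map_sum, coeff_monomial]

lemma central_sum_monomial (s : Finset ℤ) (f : ℤ → 𝔤) :
    (∑ m ∈ s, monomial m (f m)).central = 0 :=
  (map_sum centralₗ _ s).trans (Finset.sum_eq_zero fun _ _ => rfl)

lemma deg_sum_monomial (s : Finset ℤ) (f : ℤ → 𝔤) : (∑ m ∈ s, monomial m (f m)).deg = 0 :=
  (map_sum degₗ _ s).trans (Finset.sum_eq_zero fun _ _ => rfl)

lemma eq_sum_monomial {x : UntwistedAffine 𝔤} (hc : x.central = 0) (hd : x.deg = 0) {s : Finset ℤ}
    (hs : ∀ k ∉ s, coeff k x = 0) : x = ∑ k ∈ s, monomial k (coeff k x) := by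
  refine ext_coeff (fun k => ?_) (hc.trans (central_sum_monomial s _).symm)
    (hd.trans (deg_sum_monomial s _).symm)
  rw [coeff_sum_monomial]
  split_ifs with h
  · rfl
  · exact hs k h

lemma toFinsupp_loopMonomial (m k : ℤ) (a : 𝔤) :
    LoopAlgebra.toFinsupp ℂ ℤ 𝔤 (loopMonomial m a) k = if m = k then a else 0 := by
  rw [loopMonomial, LinearEquiv.apply_symm_apply, Finsupp.single_apply]

lemma toFinsupp_loopMonomial_lie (m k : ℤ) (a : 𝔤) (g : loopAlgebra ℂ ℤ 𝔤) :
    LoopAlgebra.toFinsupp ℂ ℤ 𝔤 ⁅loopMonomial m a, g⁆ k =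
      ⁅a, LoopAlgebra.toFinsupp ℂ ℤ 𝔤 g (k - m)⁆ := by
  have key : (Finsupp.lapply k ∘ₗ (LoopAlgebra.toFinsupp ℂ ℤ 𝔤).toLinearMap) ∘ₗ
      (LieModule.toEnd ℂ (loopAlgebra ℂ ℤ 𝔤) (loopAlgebra ℂ ℤ 𝔤) (loopMonomial m a)) =
      (LieModule.toEnd ℂ 𝔤 𝔤 a) ∘ₗ Finsupp.lapply (k - m) ∘ₗ
        (LoopAlgebra.toFinsupp ℂ ℤ 𝔤).toLinearMap := by
    refine loop_ext fun j y => ?_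
    simp only [LinearMap.comp_apply, LieModule.toEnd_apply_apply, lie_monomial,
      LinearEquiv.coe_coe, Finsupp.lapply_apply, toFinsupp_loopMonomial]
    by_cases h : m + j = k
    · rw [if_pos h, if_pos (by lia)]
    · rw [if_neg h, if_neg (by lia), lie_zero]
  exact LinearMap.congr_fun key g

lemma toFinsupp_lie (f g : loopAlgebra ℂ ℤ 𝔤) (k : ℤ) :
    LoopAlgebra.toFinsupp ℂ ℤ 𝔤 ⁅f, g⁆ k =
      (LoopAlgebra.toFinsupp ℂ ℤ 𝔤 f).sum fun m a =>
        ⁅a, LoopAlgebra.toFinsupp ℂ ℤ 𝔤 g (k - m)⁆ := by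
  obtain ⟨F, rfl⟩ := (LoopAlgebra.toFinsupp ℂ ℤ 𝔤).symm.surjective f
  rw [LinearEquiv.apply_symm_apply]
  induction F using Finsupp.induction_linear with
  | zero =>
    have h : ⁅(0 : loopAlgebra ℂ ℤ 𝔤), g⁆ = 0 := zero_lie g
    rw [map_zero, Finsupp.sum_zero_index, h, map_zero, Finsupp.zero_apply]
  | add F G hF hG =>
    have h : ∀ a b : loopAlgebra ℂ ℤ 𝔤, ⁅a + b, g⁆ = ⁅a, g⁆ + ⁅b, g⁆ := fun a b => add_lie a b g
    rw [map_add, h, map_add, Finsupp.add_apply, hF, hG, Finsupp.sum_add_index'] <;> simp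
  | single m a =>
    rw [Finsupp.sum_single_index (zero_lie _)]
    exact toFinsupp_loopMonomial_lie m k a g

lemma toFinsupp_loopDeriv (f : loopAlgebra ℂ ℤ 𝔤) (k : ℤ) :
    LoopAlgebra.toFinsupp ℂ ℤ 𝔤 (loopDeriv f) k =
      (k : ℂ) • LoopAlgebra.toFinsupp ℂ ℤ 𝔤 f k := by
  have key : (Finsupp.lapply k ∘ₗ (LoopAlgebra.toFinsupp ℂ ℤ 𝔤).toLinearMap) ∘ₗ loopDeriv =
      (k : ℂ) • (Finsupp.lapply k ∘ₗ (LoopAlgebra.toFinsupp ℂ ℤ 𝔤).toLinearMap) := by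
    refine loop_ext fun j y => ?_
    simp only [LinearMap.comp_apply, loopDeriv_monomial, LinearMap.smul_apply, map_smul,
      LinearEquiv.coe_coe, Finsupp.lapply_apply, toFinsupp_loopMonomial]
    split_ifs with h
    · rw [h]
    · rw [smul_zero, smul_zero]
  exact LinearMap.congr_fun key f

lemma coeff_lie (x y : UntwistedAffine 𝔤) (k : ℤ) (s : Finset ℤ)
    (hs : ∀ m ∉ s, ⁅coeff m x, coeff (k - m) y⁆ = 0) :
    coeff k ⁅x, y⁆ = ∑ m ∈ s, ⁅coeff m x, coeff (k - m) y⁆ +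
      (x.deg * k) • coeff k y - (y.deg * k) • coeff k x := by
  rw [coeff_eq, lie_eq_mk, map_sub, map_add, map_smul, map_smul, Finsupp.sub_apply,
    Finsupp.add_apply, Finsupp.smul_apply, Finsupp.smul_apply, toFinsupp_loopDeriv,
    toFinsupp_loopDeriv, toFinsupp_lie, finsupp_sum_eq_sum_of_notMem _ _ (by simp) s hs, smul_smul,
    smul_smul]
  rfl

lemma central_lie_eq_zero {x y : UntwistedAffine 𝔤}
    (h : ∀ m ≠ 0, coeff m x = 0 ∨ coeff (-m) y = 0) : ⁅x, y⁆.central = 0 := by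
  rw [lie_eq_mk, loopCocycle_apply, LoopAlgebra.residuePairing_apply_apply]
  refine Finset.sum_eq_zero fun m _ => ?_
  by_cases hm : m = 0
  · simp [hm]
  · rcases h m hm with h | h <;> rw [coeff_eq] at h <;> simp [h]

section NonnegDegrees

variable {x y : UntwistedAffine 𝔤} (hx : ∀ k < 0, coeff k x = 0) (hy : ∀ k < 0, coeff k y = 0)
include hx hy

lemma lie_coeff_eq_zero_of_notMem_Icc {k m : ℤ} (hm : m ∉ Finset.Icc 0 k) :
    ⁅coeff m x, coeff (k - m) y⁆ = 0 := by
  rw [Finset.mem_Icc, not_and_or] at hm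
  rcases hm with hm | hm
  · rw [hx m (by lia), zero_lie]
  · rw [hy (k - m) (by lia), lie_zero]

lemma coeff_lie_eq_zero_of_neg {k : ℤ} (hk : k < 0) : coeff k ⁅x, y⁆ = 0 := by
  rw [coeff_lie x y k _ fun m => lie_coeff_eq_zero_of_notMem_Icc hx hy, hx k hk, hy k hk,
    Finset.Icc_eq_empty (by lia)]
  simp

lemma coeff_zero_lie : coeff 0 ⁅x, y⁆ = ⁅coeff 0 x, coeff 0 y⁆ := by
  rw [coeff_lie x y 0 _ fun m => lie_coeff_eq_zero_of_notMem_Icc hx hy]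
  simp

lemma coeff_one_lie : coeff 1 ⁅x, y⁆ = ⁅coeff 0 x, coeff 1 y⁆ + ⁅coeff 1 x, coeff 0 y⁆ +
    x.deg • coeff 1 y - y.deg • coeff 1 x := by
  rw [coeff_lie x y 1 _ fun m => lie_coeff_eq_zero_of_notMem_Icc hx hy,
    show Finset.Icc (0 : ℤ) 1 = {0, 1} from rfl, Finset.sum_pair zero_ne_one]
  simp

lemma central_lie_eq_zero_of_nonneg : ⁅x, y⁆.central = 0 := by
  refine central_lie_eq_zero fun m hm => ?_
  rcases lt_or_gt_of_ne hm with hm | hm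
  · exact Or.inl (hx m hm)
  · exact Or.inr (hy (-m) (by lia))

end NonnegDegrees

lemma deg_lie (x y : UntwistedAffine 𝔤) : ⁅x, y⁆.deg = 0 := rfl

end UntwistedAffine

namespace TypeB

open UntwistedAffine

variable {n : ℕ}

/-! ### Root vectors of type `B` -/

/-- The index set of the basis `u_0`, `u_i`, `u_{-i}`. -/
abbrev Idx (n : ℕ) := Unit ⊕ Fin n ⊕ Fin n

/-- The involution of the index set that fixes `u_0` and exchanges `u_i` with `u_{-i}`; the
symmetric form pairs `u_p` nontrivially with `u_{opp p}` only. -/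
def opp : Idx n → Idx n
  | Sum.inl _ => Sum.inl ()
  | Sum.inr (Sum.inl i) => Sum.inr (Sum.inr i)
  | Sum.inr (Sum.inr i) => Sum.inr (Sum.inl i)

/-- The value of the symmetric form on `u_p` and `u_{opp p}`. -/
def formValue : Idx n → ℂ
  | Sum.inl _ => 2
  | Sum.inr _ => 1

@[simp] lemma opp_opp (p : Idx n) : opp (opp p) = p := by
  rcases p with _ | _ | _ <;> rfl

lemma opp_injective : Function.Injective (opp : Idx n → Idx n) :=
  Function.LeftInverse.injective opp_opp

lemma opp_eq_iff {p q : Idx n} : opp p = q ↔ p = opp q :=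
  ⟨fun h => by rw [← h, opp_opp], fun h => by rw [h, opp_opp]⟩

@[simp] lemma formValue_opp (p : Idx n) : formValue (opp p) = formValue p := by
  rcases p with _ | _ | _ <;> rfl

lemma formValue_ne_zero (p : Idx n) : formValue p ≠ 0 := by
  rcases p with _ | _ <;> simp [formValue]

lemma basisPos_le (p : Idx n) : basisPos p ≤ 2 * n := by
  rcases p with _ | i | i <;> simp only [basisPos] <;> lia

lemma basisPos_opp (p : Idx n) : basisPos (opp p) = 2 * n - basisPos p := by
  rcases p with _ | i | i <;> simp only [basisPos, opp] <;> lia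

lemma basisPos_injective : Function.Injective (basisPos : Idx n → ℕ) := by
  intro p q h
  rcases p with _ | i | i <;> rcases q with _ | j | j <;> simp only [basisPos] at h
  · rfl
  · lia
  · lia
  · lia
  · congr 2; exact Fin.ext h
  · lia
  · lia
  · lia
  · congr 2; exact Fin.ext (by lia)

lemma exists_basisPos_eq {k : ℕ} (h : k ≤ 2 * n) : ∃ p : Idx n, basisPos p = k := by
  rcases lt_trichotomy k n with hk | hk | hk
  · exact ⟨Sum.inr (Sum.inl ⟨k, hk⟩), rfl⟩
  · exact ⟨Sum.inl (), hk.symm⟩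
  · refine ⟨Sum.inr (Sum.inr ⟨2 * n - k, by lia⟩), ?_⟩
    simp only [basisPos]
    lia

lemma eq_opp_iff {p q : Idx n} : q = opp p ↔ basisPos p + basisPos q = 2 * n := by
  have := basisPos_le p
  rw [← basisPos_injective.eq_iff, basisPos_opp]
  lia

lemma JB_apply (p q : Idx n) :
    Orthogonal.JB (Fin n) ℂ p q = if q = opp p then formValue p else 0 := by
  rcases p with _ | i | i <;> rcases q with _ | j | j <;>
    simp [Orthogonal.JB, Orthogonal.JD, opp, formValue, Matrix.one_apply, eq_comm]

lemma mem_soB_iff (A : Matrix (Idx n) (Idx n) ℂ) :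
    A ∈ SoB n ↔ ∀ p q, formValue q * A (opp q) (opp p) = -(formValue p * A p q) := by
  rw [SoB, Orthogonal.typeB, mem_skewAdjointMatricesLieSubalgebra, mem_skewAdjointMatricesSubmodule,
    Matrix.IsSkewAdjoint, Matrix.IsAdjointPair, ← Matrix.ext_iff]
  have h1 : ∀ p q, (A.transpose * Orthogonal.JB (Fin n) ℂ) p q = A (opp q) p * formValue q := by
    intro p q
    rw [Matrix.mul_apply, Finset.sum_eq_single (opp q)]
    · simp [JB_apply]
    · intro r _ hr
      rw [JB_apply, if_neg, mul_zero]
      rintro rfl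
      simp at hr
    · simp
  have h2 : ∀ p q, (Orthogonal.JB (Fin n) ℂ * -A) p q = -(formValue p * A (opp p) q) := by
    intro p q
    rw [Matrix.mul_apply, Finset.sum_eq_single (opp p)]
    · simp [JB_apply]
    · intro r _ hr
      rw [JB_apply, if_neg hr, zero_mul]
    · simp
  simp only [h1, h2]
  refine ⟨fun h p q => ?_, fun h p q => ?_⟩ <;>
  · have := h (opp p) q
    rw [opp_opp, formValue_opp] at this
    linear_combination this

lemma apply_opp_opp (A : SoB n) (p q : Idx n) :
    formValue q * A.1 (opp q) (opp p) = -(formValue p * A.1 p q) :=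
  (mem_soB_iff A.1).mp A.2 p q

lemma apply_opp_opp_eq_zero_iff (A : SoB n) (p q : Idx n) :
    A.1 (opp q) (opp p) = 0 ↔ A.1 p q = 0 := by
  have h := apply_opp_opp A p q
  have hp := formValue_ne_zero p
  have hq := formValue_ne_zero q
  constructor <;> intro h0 <;> rw [h0] at h <;> simp_all

lemma apply_opp_eq_zero (A : SoB n) (p : Idx n) : A.1 p (opp p) = 0 := by
  have h := apply_opp_opp A p (opp p)
  rw [opp_opp, formValue_opp] at h
  have hp := formValue_ne_zero p
  have : formValue p * A.1 p (opp p) = 0 := by linear_combination h / 2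
  simpa [hp] using this

lemma single_sub_single_mem_soB (p q : Idx n) :
    Matrix.single p q (formValue q) - Matrix.single (opp q) (opp p) (formValue p) ∈ SoB n := by
  rw [mem_soB_iff]
  intro a b
  have h1 : p = opp b ∧ q = opp a ↔ opp q = a ∧ opp p = b := by
    rw [opp_eq_iff, opp_eq_iff, and_comm]
  have h2 : opp q = opp b ∧ opp p = opp a ↔ p = a ∧ q = b := by
    rw [opp_injective.eq_iff, opp_injective.eq_iff, and_comm]
  simp only [Matrix.sub_apply, Matrix.single_apply, h1, h2]
  split_ifs with h h' h'
  · have hw : formValue q = formValue p := by rw [h'.2, ← h.2, formValue_opp]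
    obtain ⟨rfl, rfl⟩ := h
    simp [hw]
  · obtain ⟨rfl, rfl⟩ := h
    simp [mul_comm]
  · obtain ⟨rfl, rfl⟩ := h'
    simp [mul_comm]
  · simp

/-- The root vector of weight `e_p - e_q`, where `e_p` is the weight of `u_p`; it lies in the Cartan
subalgebra for `p = q` and is zero for `q = opp p`. -/
def rootMat (p q : Idx n) : SoB n :=
  ⟨Matrix.single p q (formValue q) - Matrix.single (opp q) (opp p) (formValue p),
    single_sub_single_mem_soB p q⟩

lemma rootMat_apply (p q a b : Idx n) : (rootMat p q).1 a b =
    (if p = a ∧ q = b then formValue q else 0) -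
      (if opp q = a ∧ opp p = b then formValue p else 0) := by
  simp only [rootMat, Matrix.sub_apply, Matrix.single_apply]

lemma rootMat_apply_self {p q : Idx n} (h : q ≠ opp p) : (rootMat p q).1 p q = formValue q := by
  rw [rootMat_apply, if_pos ⟨rfl, rfl⟩, if_neg, sub_zero]
  rintro ⟨-, h'⟩
  exact h h'.symm

lemma rootMat_apply_of_ne {p q a b : Idx n} (h1 : ¬ (p = a ∧ q = b))
    (h2 : ¬ (opp q = a ∧ opp p = b)) : (rootMat p q).1 a b = 0 := by
  rw [rootMat_apply, if_neg h1, if_neg h2, sub_zero]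

lemma rootMat_opp_opp (p q : Idx n) : rootMat (opp q) (opp p) = -rootMat p q := by
  apply Subtype.ext
  ext a b
  simp only [NegMemClass.coe_neg, Matrix.neg_apply, rootMat_apply, opp_opp, formValue_opp]
  ring

lemma rootMat_lie {p q r : Idx n} (hqr : q ≠ opp r) (hqp : q ≠ opp p) (hpr : p ≠ r) :
    ⁅rootMat p q, rootMat q r⁆ = formValue q • rootMat p r := by
  apply Subtype.ext
  rw [LieSubalgebra.coe_bracket, Ring.lie_def]
  have h1 : r ≠ opp q := fun h => hqr (by rw [h, opp_opp])
  have h2 : opp p ≠ opp r := opp_injective.ne hpr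
  have h3 : opp q ≠ p := fun h => hqp (by rw [← h, opp_opp])
  simp only [rootMat, sub_mul, mul_sub, Matrix.single_mul_single_same, SetLike.val_smul,
    Matrix.single_mul_single_of_ne _ _ _ _ hqr, Matrix.single_mul_single_of_ne _ _ _ _ hqp.symm,
    Matrix.single_mul_single_of_ne _ _ _ _ h2, Matrix.single_mul_single_of_ne _ _ _ _ hpr.symm,
    Matrix.single_mul_single_of_ne _ _ _ _ h1,
    Matrix.single_mul_single_of_ne _ _ _ _ h3,
    smul_sub, Matrix.smul_single, smul_eq_mul]
  simp only [mul_comm (formValue q)]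
  abel

lemma rootMat_lie_middle {p : Idx n} (hp : p ≠ Sum.inl ()) :
    ⁅rootMat p (Sum.inl ()), rootMat (Sum.inl ()) p⁆ = (2 : ℂ) • rootMat p p := by
  apply Subtype.ext
  rw [LieSubalgebra.coe_bracket, Ring.lie_def]
  have h0 : opp (Sum.inl () : Idx n) = Sum.inl () := rfl
  have hs : opp p ≠ Sum.inl () := fun h => hp (by rw [opp_eq_iff.mp h, h0])
  simp only [rootMat, sub_mul, mul_sub, Matrix.single_mul_single_same, SetLike.val_smul, h0,
    Matrix.single_mul_single_of_ne _ _ _ _ hs, Matrix.single_mul_single_of_ne _ _ _ _ hs.symm,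
    Matrix.single_mul_single_of_ne _ _ _ _ hp, Matrix.single_mul_single_of_ne _ _ _ _ hp.symm,
    smul_sub, Matrix.smul_single, smul_eq_mul]
  have h2 : formValue (Sum.inl () : Idx n) = 2 := rfl
  simp only [h2, mul_comm]
  abel

lemma eq_sum_rootMat (A : SoB n) :
    A = (2 : ℂ)⁻¹ • ∑ p, ∑ q, (A.1 p q / formValue q) • rootMat p q := by
  apply Subtype.ext
  ext a b
  have h1 : ∀ f : Idx n → Idx n → ℂ, (∑ p, ∑ q, if p = a ∧ q = b then f p q else 0) = f a b := by
    intro f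
    simp only [ite_and]
    rw [Finset.sum_eq_single a (by intro p _ hp; simp [hp]) (by simp)]
    simp
  have h2 : ∀ f : Idx n → Idx n → ℂ,
      (∑ p, ∑ q, if opp q = a ∧ opp p = b then f p q else 0) = f (opp b) (opp a) := by
    intro f
    have : ∀ p q : Idx n, (opp q = a ∧ opp p = b) ↔ (p = opp b ∧ q = opp a) := by
      intro p q
      rw [opp_eq_iff, opp_eq_iff, and_comm]
    simp only [this, ite_and]
    rw [Finset.sum_eq_single (opp b) (by intro p _ hp; simp [hp]) (by simp)]
    simp
  have h3 := apply_opp_opp A a b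
  have ha := formValue_ne_zero a
  have hb := formValue_ne_zero b
  simp only [SetLike.val_smul, Matrix.smul_apply, AddSubmonoidClass.coe_finsetSum,
    Matrix.sum_apply, rootMat_apply, smul_eq_mul, mul_sub, mul_ite, mul_zero,
    Finset.sum_sub_distrib, h1, h2, formValue_opp]
  field_simp
  linear_combination h3

/-- The coordinate at `e_i` of the weight of the basis vector `u_p`. -/
def weightCoord (i : Fin n) : Idx n → ℤ
  | Sum.inl _ => 0
  | Sum.inr (Sum.inl j) => if j = i then 1 else 0
  | Sum.inr (Sum.inr j) => if j = i then -1 else 0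

lemma weightCoord_opp (i : Fin n) (p : Idx n) : weightCoord i (opp p) = -weightCoord i p := by
  rcases p with _ | j | j <;> simp only [weightCoord, opp] <;> (try split_ifs) <;> norm_num

lemma eq_or_of_weightCoord_add {a b a' b' : Idx n}
    (h : ∀ i, weightCoord i a + weightCoord i b = weightCoord i a' + weightCoord i b') :
    (b = opp a ∧ b' = opp a') ∨ (a' = a ∧ b' = b) ∨ (a' = b ∧ b' = a) := by
  rcases a with _ | a | a <;> rcases b with _ | b | b <;> rcases a' with _ | a' | a' <;>
    rcases b' with _ | b' | b' <;> simp only [weightCoord, opp] at h ⊢ <;> (try have h1 := h a) <;>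
    (try have h2 := h b) <;> (try have h3 := h a') <;> (try have h4 := h b') <;> clear h <;> grind

lemma eq_or_of_weightCoord_sub {p q p' q' : Idx n}
    (h : ∀ i, weightCoord i p - weightCoord i q = weightCoord i p' - weightCoord i q') :
    (p = q ∧ p' = q') ∨ (p' = p ∧ q' = q) ∨ (p' = opp q ∧ q' = opp p) := by
  have := eq_or_of_weightCoord_add (a := p) (b := opp q) (a' := p') (b' := opp q')
    (fun i => by rw [weightCoord_opp, weightCoord_opp]; linarith [h i])
  rcases this with ⟨h1, h2⟩ | ⟨h1, h2⟩ | ⟨h1, h2⟩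
  · exact Or.inl ⟨(opp_injective h1).symm, (opp_injective h2).symm⟩
  · exact Or.inr (Or.inl ⟨h1, opp_injective h2⟩)
  · exact Or.inr (Or.inr ⟨h1, by rw [← h2, opp_opp]⟩)

lemma rootMat_diag_apply (i : Fin n) (p q : Idx n) :
    (rootMat (Sum.inr (Sum.inl i)) (Sum.inr (Sum.inl i))).1 p q =
      if p = q then (weightCoord i p : ℂ) else 0 := by
  rw [rootMat_apply]
  rcases p with _ | j | j <;> rcases q with _ | k | k <;>
    simp [opp, weightCoord, formValue] <;> grind

lemma rootMat_self_mem_finCartan (p : Idx n) : rootMat p p ∈ finCartan n := by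
  intro a b hab
  refine rootMat_apply_of_ne ?_ ?_ <;> rintro ⟨h, h'⟩ <;> exact hab (h.symm.trans h')

lemma cartan_lie_apply {H : SoB n} (hH : H ∈ finCartan n) (A : SoB n) (p q : Idx n) :
    (⁅H, A⁆ : SoB n).1 p q = (H.1 p p - H.1 q q) * A.1 p q := by
  rw [coe_lie_apply, Finset.sum_eq_single p, Finset.sum_eq_single q]
  · ring
  · intro r _ hr; simp [hH r q hr]
  · simp
  · intro r _ hr; simp [hH p r hr.symm]
  · simp

/-! ### Root spaces of the affine Lie algebra -/

/-- The `(p, q)` entry of the coefficient at `t ^ k`, as a linear functional. -/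
def entry (k : ℤ) (p q : Idx n) : AffineB n →ₗ[ℂ] ℂ where
  toFun x := (coeff k x).1 p q
  map_add' x y := by simp
  map_smul' a x := by simp

lemma entry_eq (k : ℤ) (p q : Idx n) (x : AffineB n) : entry k p q x = (coeff k x).1 p q := rfl

lemma coeff_eq_zero_of_entry {k : ℤ} {x : AffineB n} (h : ∀ p q, entry k p q x = 0) :
    coeff k x = 0 := by
  apply Subtype.ext
  ext p q
  exact h p q

lemma ext_entry {x y : AffineB n} (h : ∀ k p q, entry k p q x = entry k p q y)
    (hc : x.central = y.central) (hd : x.deg = y.deg) : x = y :=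
  ext_coeff (fun k => Subtype.ext (Matrix.ext fun p q => h k p q)) hc hd

lemma d_mem_affineCartan : d ∈ affineCartan n := Submodule.subset_span (Or.inl (Or.inr rfl))

lemma monomial_mem_affineCartan {H : SoB n} (h : H ∈ finCartan n) :
    monomial 0 H ∈ affineCartan n := Submodule.subset_span (Or.inr ⟨H, h, rfl⟩)

lemma coeff_eq_zero_of_mem_affineCartan {x : AffineB n} (hx : x ∈ affineCartan n) {k : ℤ}
    (hk : k ≠ 0) : coeff k x = 0 := by
  have h : affineCartan n ≤ LinearMap.ker (coeff k) := by
    refine Submodule.span_le.mpr ?_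
    rintro _ ((rfl | rfl) | ⟨H, -, rfl⟩)
    · exact coeff_c k
    · exact coeff_d k
    · exact (coeff_monomial k 0 H).trans (if_neg hk.symm)
  exact h hx

lemma coeff_zero_mem_finCartan {x : AffineB n} (hx : x ∈ affineCartan n) :
    coeff 0 x ∈ finCartan n := by
  have h : affineCartan n ≤ (finCartan n).comap (coeff 0) := by
    refine Submodule.span_le.mpr ?_
    rintro _ ((rfl | rfl) | ⟨H, hH, rfl⟩) <;> rw [SetLike.mem_coe, Submodule.mem_comap]
    · exact coeff_c (𝔤 := SoB n) 0 ▸ zero_mem _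
    · exact coeff_d (𝔤 := SoB n) 0 ▸ zero_mem _
    · rwa [coeff_monomial, if_pos rfl]
  exact h hx

lemma affineNilPlus_le : affineNilPlus n ≤ LinearMap.ker centralₗ ⊓ LinearMap.ker degₗ ⊓
    (⨅ k : Set.Iio (0 : ℤ), LinearMap.ker (coeff k.1)) ⊓ (finNilPlus n).comap (coeff 0) := by
  refine Submodule.span_le.mpr ?_
  rintro _ (⟨A, hA, rfl⟩ | ⟨m, A, hm, rfl⟩) <;>
    refine ⟨⟨⟨rfl, rfl⟩, (Submodule.mem_iInf _).mpr ?_⟩, ?_⟩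
  · exact fun k => (coeff_monomial k.1 0 A).trans (if_neg k.2.ne')
  · rwa [SetLike.mem_coe, Submodule.mem_comap, coeff_monomial, if_pos rfl]
  · exact fun k => (coeff_monomial k.1 m A).trans (if_neg (k.2.trans hm).ne')
  · rw [SetLike.mem_coe, Submodule.mem_comap, coeff_monomial, if_neg hm.ne']
    exact zero_mem _

lemma mem_affineNilPlus_iff {x : AffineB n} :
    x ∈ affineNilPlus n ↔ x.central = 0 ∧ x.deg = 0 ∧ (∀ k < 0, coeff k x = 0) ∧
      coeff 0 x ∈ finNilPlus n := by
  refine ⟨fun hx => ?_, ?_⟩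
  · obtain ⟨⟨⟨hc, hd⟩, hneg⟩, h0⟩ := affineNilPlus_le hx
    exact ⟨hc, hd, fun k hk => (Submodule.mem_iInf _).mp hneg ⟨k, hk⟩, h0⟩
  · rintro ⟨hc, hd, hneg, h0⟩
    obtain ⟨s, hs⟩ := exists_finset_coeff_eq_zero x
    rw [eq_sum_monomial hc hd hs]
    refine Submodule.sum_mem _ fun k _ => ?_
    rcases lt_trichotomy k 0 with hk | rfl | hk
    · rw [hneg k hk, monomial_zero]; exact zero_mem _
    · exact Submodule.subset_span (Or.inl ⟨_, h0, rfl⟩)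
    · exact Submodule.subset_span (Or.inr ⟨k, _, hk, rfl⟩)

lemma affineCartan_le_affineBorel : affineCartan n ≤ (affineBorel n).toSubmodule := le_sup_left

lemma affineNilPlus_le_affineBorel : affineNilPlus n ≤ (affineBorel n).toSubmodule := le_sup_right

lemma coeff_eq_zero_of_mem_affineBorel {x : AffineB n} (hx : x ∈ affineBorel n) {k : ℤ}
    (hk : k < 0) : coeff k x = 0 := by
  obtain ⟨h, hh, y, hy, rfl⟩ := Submodule.mem_sup.mp hx
  rw [map_add, coeff_eq_zero_of_mem_affineCartan hh hk.ne, (mem_affineNilPlus_iff.mp hy).2.2.1 k hk,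
    add_zero]

lemma coeff_zero_apply_of_mem_affineBorel {x : AffineB n} (hx : x ∈ affineBorel n) {p q : Idx n}
    (hpq : basisPos q < basisPos p) : (coeff 0 x).1 p q = 0 := by
  obtain ⟨h, hh, y, hy, rfl⟩ := Submodule.mem_sup.mp hx
  have h1 : (coeff 0 h).1 p q = 0 :=
    coeff_zero_mem_finCartan hh p q (by rintro rfl; exact lt_irrefl _ hpq)
  have h2 : (coeff 0 y).1 p q = 0 := (mem_affineNilPlus_iff.mp hy).2.2.2 p q hpq.le
  simp [h1, h2]

/-- The weight of the basis vector `u_p`. -/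
def idxWeight : Idx n → Module.Dual ℂ (affineCartan n)
  | Sum.inl _ => 0
  | Sum.inr (Sum.inl i) => eps n i
  | Sum.inr (Sum.inr i) => -eps n i

/-- The weight of the `(p, q)` entry at `t ^ k`. -/
def entryWeight (k : ℤ) (p q : Idx n) : Module.Dual ℂ (affineCartan n) :=
  (k : ℂ) • delta n + (idxWeight p - idxWeight q)

lemma idxWeight_opp (p : Idx n) : idxWeight (opp p) = -idxWeight p := by
  rcases p with _ | i | i <;> simp [opp, idxWeight]

lemma entryWeight_opp_opp (k : ℤ) (p q : Idx n) :
    entryWeight k (opp q) (opp p) = entryWeight k p q := by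
  rw [entryWeight, entryWeight, idxWeight_opp, idxWeight_opp]
  abel

lemma entryWeight_self (k : ℤ) (p : Idx n) : entryWeight k p p = (k : ℂ) • delta n := by
  rw [entryWeight, sub_self, add_zero]

lemma idxWeight_apply (h : affineCartan n) (p : Idx n) :
    idxWeight p h = (coeff 0 (h : AffineB n)).1 p p := by
  rcases p with _ | i | i
  · exact (apply_opp_eq_zero _ (Sum.inl ())).symm
  · rfl
  · have := apply_opp_opp (coeff 0 (h : AffineB n)) (Sum.inr (Sum.inl i)) (Sum.inr (Sum.inl i))
    simp only [formValue, opp, one_mul] at this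
    rw [this]
    rfl

lemma entry_cartan_lie (h : affineCartan n) (x : AffineB n) (k : ℤ) (p q : Idx n) :
    entry k p q ⁅(h : AffineB n), x⁆ = entryWeight k p q h * entry k p q x := by
  have h1 : ∀ k ≠ 0, coeff k (h : AffineB n) = 0 := fun _ =>
    coeff_eq_zero_of_mem_affineCartan h.2
  have h3 : (x.deg * k) • coeff k (h : AffineB n) = 0 := by
    by_cases hk : k = 0
    · simp [hk]
    · rw [h1 k hk, smul_zero]
  have key := coeff_lie (h : AffineB n) x k {0} (fun _ hm => by
    rw [h1 _ (by simpa using hm), zero_lie])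
  rw [Finset.sum_singleton, h3, sub_zero, sub_zero] at key
  rw [entry_eq, key]
  change (⁅coeff 0 (h : AffineB n), coeff k x⁆ : SoB n).1 p q +
    (((h : AffineB n).deg * k) • coeff k x).1 p q = _
  rw [cartan_lie_apply (coeff_zero_mem_finCartan h.2), ← idxWeight_apply, ← idxWeight_apply]
  simp only [entryWeight, LinearMap.add_apply, LinearMap.smul_apply, LinearMap.sub_apply, entry_eq,
    smul_eq_mul, SetLike.val_smul, Matrix.smul_apply]
  have : delta n h = (h : AffineB n).deg := rfl
  rw [this]
  ring

lemma central_cartan_lie (h : affineCartan n) (x : AffineB n) :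
    (⁅(h : AffineB n), x⁆ : AffineB n).central = 0 :=
  central_lie_eq_zero fun _ hm => Or.inl (coeff_eq_zero_of_mem_affineCartan h.2 hm)

/-- The derivation `d` as an element of `𝔥̃`; weights read off the degree in `t` there. -/
def cartanD (n : ℕ) : affineCartan n := ⟨d, d_mem_affineCartan⟩

/-- The element of `𝔥 ⊗ 1` dual to `e_i`. -/
def cartanH (i : Fin n) : affineCartan n :=
  ⟨monomial 0 (rootMat (Sum.inr (Sum.inl i)) (Sum.inr (Sum.inl i))),
    monomial_mem_affineCartan (rootMat_self_mem_finCartan _)⟩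

lemma entryWeight_cartanD (k : ℤ) (p q : Idx n) : entryWeight k p q (cartanD n) = k := by
  have h1 : ∀ p : Idx n, idxWeight p (cartanD n) = 0 := by
    intro p
    rw [idxWeight_apply, cartanD, coeff_d]
    rfl
  have h2 : delta n (cartanD n) = 1 := rfl
  simp [entryWeight, h1, h2]

lemma entryWeight_cartanH (k : ℤ) (p q : Idx n) (i : Fin n) :
    entryWeight k p q (cartanH i) = ((weightCoord i p - weightCoord i q : ℤ) : ℂ) := by
  have h1 : ∀ p : Idx n, idxWeight p (cartanH i) = weightCoord i p := by
    intro p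
    rw [idxWeight_apply, cartanH, coeff_monomial, if_pos rfl, rootMat_diag_apply, if_pos rfl]
  have h2 : delta n (cartanH i) = 0 := rfl
  simp [entryWeight, h1, h2]

lemma eq_or_of_entryWeight_eq {k k' : ℤ} {p q p' q' : Idx n}
    (h : entryWeight k p q = entryWeight k' p' q') :
    k = k' ∧ ((p = q ∧ p' = q') ∨ (p' = p ∧ q' = q) ∨ (p' = opp q ∧ q' = opp p)) := by
  refine ⟨?_, eq_or_of_weightCoord_sub fun i => ?_⟩
  · have := LinearMap.congr_fun h (cartanD n)
    rw [entryWeight_cartanD, entryWeight_cartanD] at this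
    exact_mod_cast this
  · have := LinearMap.congr_fun h (cartanH i)
    rw [entryWeight_cartanH, entryWeight_cartanH] at this
    exact_mod_cast this

lemma eq_entryWeight_of_entry_ne_zero {α : Module.Dual ℂ (affineCartan n)} {x : AffineB n}
    (hx : x ∈ affineRootSpace n α) {k : ℤ} {p q : Idx n} (h : entry k p q x ≠ 0) :
    α = entryWeight k p q := by
  ext1 t
  have h1 := entry_cartan_lie t x k p q
  rw [show ⁅(t : AffineB n), x⁆ = α t • x from hx t, map_smul, smul_eq_mul] at h1
  exact mul_right_cancel₀ h h1

lemma central_deg_of_mem_rootSpace {α : Module.Dual ℂ (affineCartan n)} (hα : α ≠ 0)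
    {x : AffineB n} (hx : x ∈ affineRootSpace n α) : x.central = 0 ∧ x.deg = 0 := by
  obtain ⟨t, ht⟩ : ∃ t, α t ≠ 0 := by
    by_contra! h
    exact hα (LinearMap.ext h)
  have h1 : ⁅(t : AffineB n), x⁆ = α t • x := hx t
  have h2 := central_cartan_lie t x
  have h3 := deg_lie (t : AffineB n) x
  rw [h1, smul_eq_mk] at h2 h3
  simp only [smul_eq_mul, mul_eq_zero, ht, false_or] at h2 h3
  exact ⟨h2, h3⟩

/-- The root vector `rootMat p q ⊗ t ^ k`. -/
def rootVec (k : ℤ) (p q : Idx n) : AffineB n := monomial k (rootMat p q)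

lemma rootVec_opp_opp (k : ℤ) (p q : Idx n) : rootVec k (opp q) (opp p) = -rootVec k p q := by
  rw [rootVec, rootMat_opp_opp, rootVec, ← neg_one_smul ℂ, monomial_smul, neg_one_smul]

lemma entry_rootVec (k m : ℤ) (p q a b : Idx n) :
    entry m a b (rootVec k p q) = if k = m then (rootMat p q).1 a b else 0 := by
  rw [entry_eq, rootVec, coeff_monomial]
  split_ifs <;> rfl

lemma entry_rootVec_self (k : ℤ) {p q : Idx n} (h : q ≠ opp p) :
    entry k p q (rootVec k p q) ≠ 0 := by
  rw [entry_rootVec, if_pos rfl, rootMat_apply_self h]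
  exact formValue_ne_zero q

lemma eq_or_of_entry_rootVec_ne_zero {k m : ℤ} {p q a b : Idx n}
    (h : entry m a b (rootVec k p q) ≠ 0) :
    m = k ∧ ((a = p ∧ b = q) ∨ (a = opp q ∧ b = opp p)) := by
  rw [entry_rootVec] at h
  split_ifs at h with hk
  · refine ⟨hk.symm, ?_⟩
    by_contra hc
    push Not at hc
    refine h (rootMat_apply_of_ne ?_ ?_)
    · rintro ⟨rfl, rfl⟩; exact hc.1 rfl rfl
    · rintro ⟨rfl, rfl⟩; exact hc.2 rfl rfl
  · exact absurd rfl h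

lemma rootVec_mem_rootSpace (k : ℤ) (p q : Idx n) :
    rootVec k p q ∈ affineRootSpace n (entryWeight k p q) := by
  intro t
  refine ext_entry (fun m a b => ?_) ?_ ?_
  · rw [entry_cartan_lie, map_smul, smul_eq_mul]
    by_cases h : entry m a b (rootVec k p q) = 0
    · rw [h, mul_zero, mul_zero]
    · obtain ⟨rfl, ⟨rfl, rfl⟩ | ⟨rfl, rfl⟩⟩ := eq_or_of_entry_rootVec_ne_zero h
      · rfl
      · rw [entryWeight_opp_opp]
  · rw [central_cartan_lie, smul_eq_mk]
    simp [rootVec, monomial]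
  · rw [deg_lie, smul_eq_mk]
    simp [rootVec, monomial]

lemma rootVec_lie (k m : ℤ) (hkm : k + m ≠ 0 ∨ k = 0) {p q r : Idx n} (hqr : q ≠ opp r)
    (hqp : q ≠ opp p) (hpr : p ≠ r) :
    ⁅rootVec k p q, rootVec m q r⁆ = formValue q • rootVec (k + m) p r := by
  rw [rootVec, rootVec, monomial_lie_monomial, rootMat_lie hqr hqp hpr, monomial_smul]
  rcases hkm with h | rfl
  · rw [if_neg h, zero_smul, add_zero]; rfl
  · simp [rootVec]

lemma rootVec_mem_affineNilPlus {k : ℤ} {p q : Idx n}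
    (h : 0 < k ∨ (k = 0 ∧ basisPos p < basisPos q)) : rootVec k p q ∈ affineNilPlus n := by
  rcases h with h | ⟨rfl, h⟩
  · exact Submodule.subset_span (Or.inr ⟨k, _, h, rfl⟩)
  · refine Submodule.subset_span (Or.inl ⟨_, fun a b hab => rootMat_apply_of_ne ?_ ?_, rfl⟩)
    · rintro ⟨rfl, rfl⟩; lia
    · rintro ⟨rfl, rfl⟩
      rw [basisPos_opp, basisPos_opp] at hab
      have := basisPos_le q
      lia

lemma exists_entryWeight_of_mem_finPosRoots {γ : Module.Dual ℂ (affineCartan n)}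
    (h : γ ∈ finPosRoots n) : ∃ p q : Idx n, γ = entryWeight 0 p q ∧ basisPos p < basisPos q ∧
      q ≠ opp p ∧ p ≠ opp p := by
  rcases h with ⟨i, rfl⟩ | ⟨i, j, hij, rfl | rfl⟩
  · refine ⟨Sum.inr (Sum.inl i), Sum.inl (), ?_, ?_, ?_, ?_⟩ <;>
      simp [entryWeight, idxWeight, basisPos, opp]
  · refine ⟨Sum.inr (Sum.inl i), Sum.inr (Sum.inl j), ?_, ?_, ?_, ?_⟩ <;>
      simp [entryWeight, idxWeight, basisPos, opp, hij]
  · refine ⟨Sum.inr (Sum.inl i), Sum.inr (Sum.inr j), ?_, ?_, ?_, ?_⟩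
    · simp [entryWeight, idxWeight]
    · simp only [basisPos]; lia
    · simp [opp, hij.ne']
    · simp [opp]

lemma delta_eq_entryWeight (p : Idx n) : delta n = entryWeight 1 p p := by
  rw [entryWeight_self, Int.cast_one, one_smul]

lemma delta_ne_zero : delta n ≠ 0 := fun h => by
  have : delta n (cartanD n) = 1 := rfl
  rw [h] at this
  simp at this

lemma entry_of_mem_rootSpace_delta {x : AffineB n} (hx : x ∈ affineRootSpace n (delta n)) {k : ℤ}
    {p q : Idx n} (h : entry k p q x ≠ 0) : k = 1 ∧ p = q := by
  have h1 := eq_entryWeight_of_entry_ne_zero hx h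
  rw [delta_eq_entryWeight (Sum.inl ())] at h1
  obtain ⟨h2, ⟨-, h3⟩ | ⟨rfl, rfl⟩ | ⟨rfl, rfl⟩⟩ := eq_or_of_entryWeight_eq h1
  · exact ⟨h2.symm, h3⟩
  · exact ⟨h2.symm, rfl⟩
  · exact ⟨h2.symm, rfl⟩

lemma isPosRoot_delta (hn : 0 < n) : IsPosRoot n (delta n) := by
  refine ⟨delta_ne_zero, ?_, fun x hx => ?_⟩
  · let p : Idx n := Sum.inr (Sum.inl ⟨0, hn⟩)
    have h1 := rootVec_mem_rootSpace 1 p p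
    rw [← delta_eq_entryWeight] at h1
    intro h
    rw [h, Submodule.mem_bot] at h1
    have h2 := entry_rootVec_self 1 (p := p) (q := p) (by simp [p, opp])
    rw [h1, map_zero] at h2
    exact h2 rfl
  · obtain ⟨hc, hd⟩ := central_deg_of_mem_rootSpace delta_ne_zero hx
    refine mem_affineNilPlus_iff.mpr ⟨hc, hd, fun k hk => coeff_eq_zero_of_entry fun p q => ?_,
      fun p q _ => ?_⟩
    · by_contra h
      have := (entry_of_mem_rootSpace_delta hx h).1
      lia
    · by_contra h
      have := (entry_of_mem_rootSpace_delta (k := 0) hx h).1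
      lia

/-! ### The ideal of a commuting pair of upper sets -/

/-- The positive roots of `B_n`, encoded as the positions `(i, q)` of the matrix entries above the
diagonal and to the left of the antidiagonal, with rows and columns numbered by `basisPos`. -/
def posRootPositions (n : ℕ) : Set (ℕ × ℕ) := {x | x.1 < x.2 ∧ x.1 + x.2 < 2 * n}

/-- An upper set of the poset of positive roots of `B_n`: going up is moving up or to the right in
the triangle `posRootPositions`. -/
structure IsUpper (n : ℕ) (A : Set (ℕ × ℕ)) : Prop where
  subset : A ⊆ posRootPositions n
  mem_of_le : ∀ {i q j r : ℕ},
    (i, q) ∈ A → (j, r) ∈ posRootPositions n → j ≤ i → q ≤ r → (j, r) ∈ A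

/-- A pair of upper sets such that no root of the first and root of the second add up to the highest
root. The highest root sits at `(0, 2 * n - 1)`, and `(1, p)` stands for the same root as its mirror
image `(2 * n - p, 2 * n - 1)`, so the pairs with that sum are `(0, 2 * n - p)` and `(1, p)`. -/
structure IsCommutingPair (n : ℕ) (A C : Set (ℕ × ℕ)) : Prop where
  left : IsUpper n A
  right : IsUpper n C
  not_left : ∀ p, 2 ≤ p → p ≤ 2 * n - 2 → (0, 2 * n - p) ∈ A → (1, p) ∉ C
  not_right : ∀ p, 2 ≤ p → p ≤ 2 * n - 2 → (0, 2 * n - p) ∈ C → (1, p) ∉ A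

variable {A C : Set (ℕ × ℕ)}

lemma IsUpper.ext {A' : Set (ℕ × ℕ)} (hA : IsUpper n A) (hA' : IsUpper n A')
    (h : ∀ x ∈ posRootPositions n, x ∈ A ↔ x ∈ A') : A = A' :=
  Set.ext fun x => ⟨fun hx => (h x (hA.subset hx)).mp hx, fun hx => (h x (hA'.subset hx)).mpr hx⟩

lemma IsCommutingPair.symm (h : IsCommutingPair n A C) :
    IsCommutingPair n C A := ⟨h.right, h.left, h.not_right, h.not_left⟩

/-- The position `(p, q)` or its mirror image in the antidiagonal lies in `A`. These are the matrix
entries at which root vectors for the roots in `A` live. -/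
def SymmMem (n : ℕ) (A : Set (ℕ × ℕ)) (p q : ℕ) : Prop :=
  (p + q < 2 * n ∧ (p, q) ∈ A) ∨ (2 * n < p + q ∧ (2 * n - q, 2 * n - p) ∈ A)

lemma SymmMem.add_ne {p q : ℕ} (h : SymmMem n A p q) : p + q ≠ 2 * n := by
  rcases h with h | h <;> lia

lemma symmMem_iff_of_add_lt {p q : ℕ} (h : p + q < 2 * n) : SymmMem n A p q ↔ (p, q) ∈ A := by
  simp [SymmMem, h, h.not_gt]

lemma IsUpper.lt_of_symmMem (hA : IsUpper n A) {p q : ℕ} (h : SymmMem n A p q) : p < q := by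
  rcases h with ⟨_, h⟩ | ⟨_, h⟩
  · exact (hA.subset h).1
  · have := (hA.subset h).1
    simp only at this
    lia

lemma symmMem_reflect {p q : ℕ} (hp : p ≤ 2 * n) (hq : q ≤ 2 * n) :
    SymmMem n A (2 * n - q) (2 * n - p) ↔ SymmMem n A p q := by
  have h1 : 2 * n - (2 * n - p) = p := by lia
  have h2 : 2 * n - (2 * n - q) = q := by lia
  unfold SymmMem
  rw [h1, h2, or_comm]
  refine or_congr (and_congr_left fun _ => ?_) (and_congr_left fun _ => ?_) <;> lia

lemma IsUpper.symmMem_mono (hA : IsUpper n A) {p q p' q' : ℕ} (h : SymmMem n A p q) (hp : p' ≤ p)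
    (hq : q ≤ q') (hq' : q' ≤ 2 * n) (hne : p' + q' ≠ 2 * n) : SymmMem n A p' q' := by
  have hpq := hA.lt_of_symmMem h
  rcases lt_or_gt_of_ne hne with hlt | hgt
  · refine Or.inl ⟨hlt, ?_⟩
    rcases h with ⟨_, h⟩ | ⟨_, h⟩
    · exact hA.mem_of_le h ⟨by simp only; lia, hlt⟩ hp hq
    · exact hA.mem_of_le h ⟨by simp only; lia, hlt⟩ (by lia) (by lia)
  · refine Or.inr ⟨hgt, ?_⟩
    have ht : (2 * n - q', 2 * n - p') ∈ posRootPositions n :=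
      ⟨by simp only; lia, by simp only; lia⟩
    rcases h with ⟨_, h⟩ | ⟨_, h⟩
    · exact hA.mem_of_le h ht (by lia) (by lia)
    · exact hA.mem_of_le h ht (by lia) (by lia)

lemma IsCommutingPair.not_symmMem_one (h : IsCommutingPair n A C) {p : ℕ} (h2 : 2 ≤ p)
    (hp : p ≤ 2 * n - 2) (hA : SymmMem n A 0 (2 * n - p)) : ¬ SymmMem n C 1 p := by
  rw [symmMem_iff_of_add_lt (by lia)] at hA ⊢
  exact h.not_left p h2 hp hA

-- Both roots are moved up, keeping their sum a root, until the sum is the highest root.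
lemma IsCommutingPair.not_symmMem (h : IsCommutingPair n A C) {r q p : ℕ} (hp : p ≤ 2 * n)
    (hrp : r + p ≠ 2 * n) (hA : SymmMem n A r q) : ¬ SymmMem n C q p := by
  intro hC
  have hrq := h.left.lt_of_symmMem hA
  have hqp := h.right.lt_of_symmMem hC
  have hA' := (symmMem_reflect (A := A) (p := r) (q := q) (by lia) (by lia)).mpr hA
  have hC' := (symmMem_reflect (A := C) (p := q) (q := p) (by lia) (by lia)).mpr hC
  have hne := hA.add_ne
  have hne' := hC.add_ne
  rcases lt_or_ge (q + p) (2 * n) with h1 | h1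
  · exact h.not_symmMem_one (by lia) (by lia)
      (h.left.symmMem_mono hA (by lia) (by lia) (by lia) (by lia))
      (h.right.symmMem_mono hC (by lia) le_rfl (by lia) (by lia))
  rcases lt_or_ge (r + q) (2 * n) with h2 | h2
  · rcases lt_or_gt_of_ne hrp with h3 | h3
    · exact h.not_symmMem_one (p := 2 * n - q) (by lia) (by lia)
        (h.left.symmMem_mono hA (by lia) (by lia) (by lia) (by lia))
        (h.right.symmMem_mono hC' (by lia) le_rfl (by lia) (by lia))
    · exact h.symm.not_symmMem_one (p := q) (by lia) (by lia)
        (h.right.symmMem_mono hC' (by lia) (by lia) (by lia) (by lia))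
        (h.left.symmMem_mono hA (by lia) le_rfl (by lia) (by lia))
  · exact h.symm.not_symmMem_one (p := 2 * n - r) (by lia) (by lia)
      (h.right.symmMem_mono hC' (by lia) (by lia) (by lia) (by lia))
      (h.left.symmMem_mono hA' (by lia) le_rfl (by lia) (by lia))

/-- The entries `(p, q)` at `t ^ k` that may be nonzero in the ideal attached to `(A, C)`: the roots
`γ ∈ A`, the roots `δ + γ` of degree one except the `δ - γ` with `γ ∈ C`, and everything in degree
at least two. -/
def IsAllowed (A C : Set (ℕ × ℕ)) (k : ℤ) (p q : Idx n) : Prop :=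
  2 ≤ k ∨ (k = 1 ∧ ¬ SymmMem n C (basisPos q) (basisPos p)) ∨
    (k = 0 ∧ SymmMem n A (basisPos p) (basisPos q))

lemma isAllowed_zero_iff {p q : Idx n} :
    IsAllowed A C 0 p q ↔ SymmMem n A (basisPos p) (basisPos q) := by
  simp [IsAllowed]

lemma isAllowed_one_iff {p q : Idx n} :
    IsAllowed A C 1 p q ↔ ¬ SymmMem n C (basisPos q) (basisPos p) := by
  simp [IsAllowed]

lemma isAllowed_opp_opp (k : ℤ) (p q : Idx n) :
    IsAllowed A C k (opp q) (opp p) ↔ IsAllowed A C k p q := by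
  unfold IsAllowed
  rw [basisPos_opp, basisPos_opp, symmMem_reflect (basisPos_le _) (basisPos_le _),
    symmMem_reflect (basisPos_le _) (basisPos_le _)]

lemma IsCommutingPair.isAllowed_one_of_le (h : IsCommutingPair n A C) {p q : Idx n}
    (hpq : basisPos p ≤ basisPos q) : IsAllowed A C 1 p q :=
  isAllowed_one_iff.mpr fun hf => hpq.not_gt (h.right.lt_of_symmMem hf)

/-- The ideal attached to `(A, C)`, as a subspace: the elements of `𝔫̃₊` whose nonzero entries are
allowed. -/
def pairSubmodule (n : ℕ) (A C : Set (ℕ × ℕ)) : Submodule ℂ (AffineB n) where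
  carrier := {x | x ∈ affineNilPlus n ∧ ∀ k p q, ¬ IsAllowed A C k p q → entry k p q x = 0}
  add_mem' hx hy := ⟨add_mem hx.1 hy.1, fun k p q h => by
    rw [map_add, hx.2 k p q h, hy.2 k p q h, add_zero]⟩
  zero_mem' := ⟨zero_mem _, fun k p q _ => map_zero _⟩
  smul_mem' a x hx := ⟨Submodule.smul_mem _ _ hx.1, fun k p q h => by
    rw [map_smul, hx.2 k p q h, smul_zero]⟩

lemma mem_pairSubmodule {x : AffineB n} : x ∈ pairSubmodule n A C ↔
    x ∈ affineNilPlus n ∧ ∀ k p q, entry k p q x ≠ 0 → IsAllowed A C k p q :=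
  and_congr_right fun _ => forall_congr' fun _ => forall_congr' fun _ => forall_congr' fun _ =>
    not_imp_comm

lemma basisPos_add_ne_of_apply_ne_zero {X : SoB n} {p q : Idx n} (h : X.1 p q ≠ 0) :
    basisPos p + basisPos q ≠ 2 * n := by
  rw [Ne, ← eq_opp_iff]
  rintro rfl
  exact h (apply_opp_eq_zero X p)

lemma coeff_zero_apply_ne_zero {x : AffineB n} (hx : x ∈ pairSubmodule n A C) {p q : Idx n}
    (h : (coeff 0 x).1 p q ≠ 0) : SymmMem n A (basisPos p) (basisPos q) :=
  isAllowed_zero_iff.mp ((mem_pairSubmodule.mp hx).2 0 p q h)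

lemma coeff_one_apply_ne_zero {x : AffineB n} (hx : x ∈ pairSubmodule n A C) {p q : Idx n}
    (h : (coeff 1 x).1 p q ≠ 0) : ¬ SymmMem n C (basisPos q) (basisPos p) :=
  isAllowed_one_iff.mp ((mem_pairSubmodule.mp hx).2 1 p q h)

lemma lie_apply_eq_zero {X Y : SoB n} {p q : Idx n} (h1 : ∀ r, X.1 p r ≠ 0 → Y.1 r q ≠ 0 → False)
    (h2 : ∀ r, Y.1 p r ≠ 0 → X.1 r q ≠ 0 → False) : (⁅X, Y⁆ : SoB n).1 p q = 0 := by
  rw [coe_lie_apply, Finset.sum_eq_zero, Finset.sum_eq_zero, sub_zero]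
  · intro r _
    by_contra h
    exact h2 r (left_ne_zero_of_mul h) (right_ne_zero_of_mul h)
  · intro r _
    by_contra h
    exact h1 r (left_ne_zero_of_mul h) (right_ne_zero_of_mul h)

lemma basisPos_le_of_apply_ne_zero {Y : SoB n} (hY : ∀ p q, basisPos q < basisPos p → Y.1 p q = 0)
    {p q : Idx n} (h : Y.1 p q ≠ 0) : basisPos p ≤ basisPos q :=
  not_lt.mp fun hlt => h (hY p q hlt)

lemma IsUpper.lie_apply_eq_zero_of_not_symmMem (hA : IsUpper n A) {X Y : SoB n}
    (hY : ∀ p q, basisPos q < basisPos p → Y.1 p q = 0)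
    (hX : ∀ p q, X.1 p q ≠ 0 → SymmMem n A (basisPos p) (basisPos q)) {p q : Idx n}
    (hpq : ¬ SymmMem n A (basisPos p) (basisPos q)) : (⁅Y, X⁆ : SoB n).1 p q = 0 := by
  by_contra h
  have hs := basisPos_add_ne_of_apply_ne_zero h
  refine h (lie_apply_eq_zero (fun r h1 h2 => hpq ?_) (fun r h1 h2 => hpq ?_))
  · exact hA.symmMem_mono (hX r q h2) (basisPos_le_of_apply_ne_zero hY h1) le_rfl (basisPos_le _) hs
  · exact hA.symmMem_mono (hX p r h1) le_rfl (basisPos_le_of_apply_ne_zero hY h2) (basisPos_le _) hs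

lemma IsUpper.lie_apply_eq_zero_of_symmMem (hC : IsUpper n C) {X Y : SoB n}
    (hY : ∀ p q, basisPos q < basisPos p → Y.1 p q = 0)
    (hX : ∀ p q, X.1 p q ≠ 0 → ¬ SymmMem n C (basisPos q) (basisPos p)) {p q : Idx n}
    (hpq : SymmMem n C (basisPos q) (basisPos p)) : (⁅Y, X⁆ : SoB n).1 p q = 0 := by
  refine lie_apply_eq_zero (fun r h1 h2 => hX r q h2 ?_) (fun r h1 h2 => hX p r h1 ?_)
  · have := basisPos_add_ne_of_apply_ne_zero h2
    exact hC.symmMem_mono hpq le_rfl (basisPos_le_of_apply_ne_zero hY h1) (basisPos_le _) (by lia)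
  · have := basisPos_add_ne_of_apply_ne_zero h1
    exact hC.symmMem_mono hpq (basisPos_le_of_apply_ne_zero hY h2) le_rfl (basisPos_le _) (by lia)

lemma IsCommutingPair.lie_apply_eq_zero (h : IsCommutingPair n A C) {X : SoB n} (Y : SoB n)
    (hX : ∀ p q, X.1 p q ≠ 0 → SymmMem n A (basisPos p) (basisPos q)) {p q : Idx n}
    (hpq : SymmMem n C (basisPos q) (basisPos p)) : (⁅Y, X⁆ : SoB n).1 p q = 0 := by
  refine TypeB.lie_apply_eq_zero (fun r h1 h2 => ?_) (fun r h1 h2 => ?_)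
  · have := basisPos_add_ne_of_apply_ne_zero h1
    exact h.not_symmMem (basisPos_le _) (by lia) (hX r q h2) hpq
  · have := basisPos_add_ne_of_apply_ne_zero h2
    exact h.symm.not_symmMem (basisPos_le _) (by lia) hpq (hX p r h1)

lemma IsCommutingPair.lie_mem_pairSubmodule (h : IsCommutingPair n A C) {x y : AffineB n}
    (hy : y ∈ affineBorel n) (hx : x ∈ pairSubmodule n A C) : ⁅y, x⁆ ∈ pairSubmodule n A C := by
  obtain ⟨-, hxd, hxneg, -⟩ := mem_affineNilPlus_iff.mp hx.1
  have hyneg : ∀ k < 0, coeff k y = 0 := fun _ => coeff_eq_zero_of_mem_affineBorel hy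
  have hyupper : ∀ p q, basisPos q < basisPos p → (coeff 0 y).1 p q = 0 := fun _ _ =>
    coeff_zero_apply_of_mem_affineBorel hy
  have hzero : ∀ p q, ¬ SymmMem n A (basisPos p) (basisPos q) → (coeff 0 ⁅y, x⁆).1 p q = 0 := by
    intro p q hpq
    rw [coeff_zero_lie hyneg hxneg]
    exact h.left.lie_apply_eq_zero_of_not_symmMem hyupper
      (fun _ _ => coeff_zero_apply_ne_zero hx) hpq
  have hone : ∀ p q, SymmMem n C (basisPos q) (basisPos p) → (coeff 1 ⁅y, x⁆).1 p q = 0 := by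
    intro p q hpq
    have h1 := h.right.lie_apply_eq_zero_of_symmMem hyupper
      (fun _ _ => coeff_one_apply_ne_zero hx) hpq
    have h2 := h.lie_apply_eq_zero (coeff 1 y) (fun _ _ => coeff_zero_apply_ne_zero hx) hpq
    have h3 : (coeff 1 x).1 p q = 0 := not_not.mp fun hne => coeff_one_apply_ne_zero hx hne hpq
    rw [coeff_one_lie hyneg hxneg, hxd, zero_smul, sub_zero]
    simp only [AddMemClass.coe_add, SetLike.val_smul, Matrix.add_apply, Matrix.smul_apply, h1, h2,
      h3, smul_zero, add_zero]
  refine ⟨mem_affineNilPlus_iff.mpr ⟨central_lie_eq_zero_of_nonneg hyneg hxneg, deg_lie y x,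
    fun _ => coeff_lie_eq_zero_of_neg hyneg hxneg, fun p q hpq => ?_⟩, fun k p q hk => ?_⟩
  · exact hzero p q fun hA => hpq.not_gt (h.left.lt_of_symmMem hA)
  · rcases (show k < 0 ∨ k = 0 ∨ k = 1 ∨ 2 ≤ k by lia) with hk' | rfl | rfl | hk'
    · rw [entry_eq, coeff_lie_eq_zero_of_neg hyneg hxneg hk']; rfl
    · exact hzero p q (mt isAllowed_zero_iff.mpr hk)
    · exact hone p q (not_not.mp (mt isAllowed_one_iff.mpr hk))
    · exact absurd (Or.inl hk') hk

/-- The basic ideal attached to a commuting pair. -/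
def pairIdeal (h : IsCommutingPair n A C) : LieIdeal ℂ (affineBorel n) where
  toSubmodule := (pairSubmodule n A C).comap (affineBorel n).toSubmodule.subtype
  lie_mem {y _} hx := h.lie_mem_pairSubmodule y.2 hx

lemma ambient_pairIdeal (h : IsCommutingPair n A C) :
    ambient (pairIdeal h) = pairSubmodule n A C := by
  rw [ambient, pairIdeal, Submodule.map_comap_subtype]
  exact inf_eq_right.mpr fun x hx => affineNilPlus_le_affineBorel hx.1

lemma IsCommutingPair.isAllowed_of_entryWeight_eq (h : IsCommutingPair n A C) {k k' : ℤ}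
    {p q p' q' : Idx n} (he : entryWeight k p q = entryWeight k' p' q')
    (ha : IsAllowed A C k p q) : IsAllowed A C k' p' q' := by
  obtain ⟨rfl, ⟨rfl, rfl⟩ | ⟨rfl, rfl⟩ | ⟨rfl, rfl⟩⟩ := eq_or_of_entryWeight_eq he
  · rcases ha with ha | ⟨rfl, -⟩ | ⟨rfl, ha⟩
    · exact Or.inl ha
    · exact h.isAllowed_one_of_le le_rfl
    · exact absurd (h.left.lt_of_symmMem ha) (lt_irrefl _)
  · exact ha
  · rwa [isAllowed_opp_opp]

lemma mem_pairSubmodule_of_coeff_eq_zero {x : AffineB n} (hx : x ∈ affineBorel n)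
    (hc : x.central = 0) (hd : x.deg = 0) (h0 : coeff 0 x = 0) (h1 : coeff 1 x = 0) :
    x ∈ pairSubmodule n A C := by
  have hneg : ∀ k < 0, coeff k x = 0 := fun _ => coeff_eq_zero_of_mem_affineBorel hx
  refine mem_pairSubmodule.mpr ⟨mem_affineNilPlus_iff.mpr ⟨hc, hd, hneg, h0 ▸ zero_mem _⟩,
    fun k p q hk => Or.inl ?_⟩
  by_contra! hlt
  have hk0 : coeff k x = 0 := by
    rcases (show k < 0 ∨ k = 0 ∨ k = 1 by lia) with hk | rfl | rfl
    exacts [hneg k hk, h0, h1]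
  exact hk (by rw [entry_eq, hk0]; rfl)

lemma finiteDimensional_quotient_pairIdeal (h : IsCommutingPair n A C) :
    FiniteDimensional ℂ (affineBorel n ⧸ (pairIdeal h).toSubmodule) := by
  let φ : affineBorel n →ₗ[ℂ] ℂ × ℂ × SoB n × SoB n :=
    (centralₗ.prod (degₗ.prod ((coeff 0).prod (coeff 1)))) ∘ₗ (affineBorel n).toSubmodule.subtype
  have hφ : LinearMap.ker φ ≤ (pairIdeal h).toSubmodule := by
    intro x hx
    obtain ⟨hc, hd, h0, h1⟩ : (x : AffineB n).central = 0 ∧ (x : AffineB n).deg = 0 ∧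
        coeff 0 (x : AffineB n) = 0 ∧ coeff 1 (x : AffineB n) = 0 := by
      have h := LinearMap.mem_ker.mp hx
      exact ⟨congrArg (·.1) h, congrArg (·.2.1) h, congrArg (·.2.2.1) h, congrArg (·.2.2.2) h⟩
    exact mem_pairSubmodule_of_coeff_eq_zero x.2 hc hd h0 h1
  have : FiniteDimensional ℂ (affineBorel n ⧸ LinearMap.ker φ) :=
    φ.quotKerEquivRange.symm.finiteDimensional
  exact Module.Finite.of_surjective (Submodule.factor hφ) (Submodule.factor_surjective hφ)

lemma IsCommutingPair.pairSubmodule_inf_rootSpace (h : IsCommutingPair n A C)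
    {α : Module.Dual ℂ (affineCartan n)} (hα : IsPosRoot n α) :
    pairSubmodule n A C ⊓ affineRootSpace n α = ⊥ ∨
      pairSubmodule n A C ⊓ affineRootSpace n α = affineRootSpace n α := by
  rw [or_iff_not_imp_left]
  intro hne
  obtain ⟨x, ⟨hxI, hxα⟩, hx0⟩ := Submodule.exists_mem_ne_zero_of_ne_bot hne
  obtain ⟨k', p', q', hk'⟩ : ∃ k' p' q', entry k' p' q' x ≠ 0 := by
    by_contra! hz
    obtain ⟨hc, hd⟩ := central_deg_of_mem_rootSpace hα.1 hxα
    exact hx0 (ext_entry (fun k p q => by rw [hz, map_zero]) hc hd)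
  refine inf_eq_right.mpr fun y hy => mem_pairSubmodule.mpr ⟨hα.2.2 hy, fun k p q hk => ?_⟩
  exact h.isAllowed_of_entryWeight_eq
    ((eq_entryWeight_of_entry_ne_zero hxα hk').symm.trans (eq_entryWeight_of_entry_ne_zero hy hk))
    ((mem_pairSubmodule.mp hxI).2 _ _ _ hk')

lemma IsCommutingPair.rootSpace_delta_le_pairSubmodule (h : IsCommutingPair n A C) (hn : 0 < n) :
    affineRootSpace n (delta n) ≤ pairSubmodule n A C := by
  intro x hx
  refine mem_pairSubmodule.mpr ⟨(isPosRoot_delta hn).2.2 hx, fun k p q hk => ?_⟩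
  obtain ⟨rfl, rfl⟩ := entry_of_mem_rootSpace_delta hx hk
  exact h.isAllowed_one_of_le le_rfl

lemma isBasicIdeal_pairIdeal (hn : 0 < n) (h : IsCommutingPair n A C) :
    IsBasicIdeal (pairIdeal h) := by
  refine ⟨⟨?_, finiteDimensional_quotient_pairIdeal h, fun α hα => ?_⟩,
    delta n, ⟨isPosRoot_delta hn, ?_⟩, Or.inl (Or.inl rfl)⟩ <;> rw [ambient_pairIdeal]
  · exact fun x hx => hx.1
  · exact h.pairSubmodule_inf_rootSpace hα
  · exact h.rootSpace_delta_le_pairSubmodule hn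

lemma rootVec_mem_pairSubmodule_iff {k : ℤ} {p q : Idx n} (hs : q ≠ opp p)
    (hpos : 0 < k ∨ (k = 0 ∧ basisPos p < basisPos q)) :
    rootVec k p q ∈ pairSubmodule n A C ↔ IsAllowed A C k p q := by
  rw [mem_pairSubmodule]
  constructor
  · intro h
    exact h.2 k p q (entry_rootVec_self k hs)
  · intro h
    refine ⟨rootVec_mem_affineNilPlus hpos, fun m a b hm => ?_⟩
    obtain ⟨rfl, ⟨rfl, rfl⟩ | ⟨rfl, rfl⟩⟩ := eq_or_of_entry_rootVec_ne_zero hm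
    · exact h
    · rwa [isAllowed_opp_opp]

lemma exists_idx_of_mem_posRootPositions {x : ℕ × ℕ} (hx : x ∈ posRootPositions n) :
    ∃ p q : Idx n, x = (basisPos p, basisPos q) := by
  obtain ⟨h1, h2⟩ := hx
  obtain ⟨p, hp⟩ := exists_basisPos_eq (n := n) (k := x.1) (by lia)
  obtain ⟨q, hq⟩ := exists_basisPos_eq (n := n) (k := x.2) (by lia)
  exact ⟨p, q, by rw [hp, hq]⟩

lemma pair_eq_of_pairSubmodule_eq {A' C' : Set (ℕ × ℕ)} (h : IsCommutingPair n A C)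
    (h' : IsCommutingPair n A' C') (he : pairSubmodule n A C = pairSubmodule n A' C') :
    A = A' ∧ C = C' := by
  refine ⟨h.left.ext h'.left fun x hx => ?_, h.right.ext h'.right fun x hx => ?_⟩ <;>
    obtain ⟨p, q, rfl⟩ := exists_idx_of_mem_posRootPositions hx <;> obtain ⟨hpq, hs⟩ := hx <;>
    rw [← symmMem_iff_of_add_lt hs, ← symmMem_iff_of_add_lt hs]
  · have hq : q ≠ opp p := fun hq => by rw [eq_opp_iff] at hq; lia
    rw [← isAllowed_zero_iff (C := C), ← isAllowed_zero_iff (C := C'),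
      ← rootVec_mem_pairSubmodule_iff hq (Or.inr ⟨rfl, hpq⟩),
      ← rootVec_mem_pairSubmodule_iff hq (Or.inr ⟨rfl, hpq⟩), he]
  · have hp : p ≠ opp q := fun hp => by rw [eq_opp_iff] at hp; lia
    rw [← not_iff_not, ← isAllowed_one_iff (A := A), ← isAllowed_one_iff (A := A'),
      ← rootVec_mem_pairSubmodule_iff hp (Or.inl one_pos),
      ← rootVec_mem_pairSubmodule_iff hp (Or.inl one_pos), he]

/-! ### The commuting pair of a basic ideal -/

variable {I : LieIdeal ℂ (affineBorel n)}

lemma ambient_injective : Function.Injective (ambient : LieIdeal ℂ (affineBorel n) → _) :=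
  fun _ _ h => LieSubmodule.toSubmodule_injective
    (Submodule.map_injective_of_injective (Submodule.subtype_injective _) h)

lemma lie_mem_ambient {x y : AffineB n} (hy : y ∈ affineBorel n) (hx : x ∈ ambient I) :
    ⁅y, x⁆ ∈ ambient I := by
  obtain ⟨x, hx, rfl⟩ := hx
  exact ⟨⁅(⟨y, hy⟩ : affineBorel n), x⁆, I.lie_mem hx, rfl⟩

lemma lie_mem_ambient_left {x y : AffineB n} (hx : x ∈ ambient I) (hy : y ∈ affineBorel n) :
    ⁅x, y⁆ ∈ ambient I := by
  rw [← lie_skew]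
  exact neg_mem (lie_mem_ambient hy hx)

-- Applying `ad t - μ t` for a Cartan element `t` that separates the weight `μ` from that of the
-- entry `(k, p, q)` kills the entries of weight `μ`; this is iterated over the weights in `F`.
lemma exists_mem_ambient_entry_eq_zero {k : ℤ} {p q : Idx n} (F : Finset (ℤ × Idx n × Idx n))
    (hF : ∀ e ∈ F, entryWeight e.1 e.2.1 e.2.2 ≠ entryWeight k p q) {x : AffineB n}
    (hx : x ∈ ambient I) (hne : entry k p q x ≠ 0) :
    ∃ y ∈ ambient I, entry k p q y ≠ 0 ∧ (∀ e ∈ F, entry e.1 e.2.1 e.2.2 y = 0) ∧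
      ∀ m a b, entry m a b x = 0 → entry m a b y = 0 := by
  classical
  induction F using Finset.induction_on with
  | empty => exact ⟨x, hx, hne, by simp, fun _ _ _ h => h⟩
  | insert e F _ ih =>
    obtain ⟨y, hy, hy1, hy2, hy3⟩ := ih fun e he => hF e (Finset.mem_insert_of_mem he)
    set μ := entryWeight e.1 e.2.1 e.2.2
    obtain ⟨t, ht⟩ : ∃ t, μ t ≠ entryWeight k p q t := by
      by_contra! h
      exact hF e (Finset.mem_insert_self _ _) (LinearMap.ext h)
    have hentry : ∀ m a b, entry m a b (⁅(t : AffineB n), y⁆ - μ t • y) =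
        (entryWeight m a b t - μ t) * entry m a b y := by
      intro m a b
      rw [map_sub, map_smul, entry_cartan_lie, smul_eq_mul, sub_mul]
    refine ⟨⁅(t : AffineB n), y⁆ - μ t • y, sub_mem
      (lie_mem_ambient (affineCartan_le_affineBorel t.2) hy) (Submodule.smul_mem _ _ hy),
      ?_, fun f hf => ?_, fun m a b h => ?_⟩
    · rw [hentry]
      exact mul_ne_zero (sub_ne_zero.mpr ht.symm) hy1
    · rw [hentry]
      rcases Finset.mem_insert.mp hf with rfl | hf
      · rw [sub_self, zero_mul]
      · rw [hy2 f hf, mul_zero]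
    · rw [hentry, hy3 m a b h, mul_zero]

lemma mem_rootSpace_of_entry {α : Module.Dual ℂ (affineCartan n)} {x : AffineB n}
    (hc : x.central = 0) (hd : x.deg = 0)
    (h : ∀ k p q, entry k p q x ≠ 0 → entryWeight k p q = α) : x ∈ affineRootSpace n α := by
  refine fun t => ext_entry (fun k p q => ?_) ?_ ?_
  · rw [entry_cartan_lie, map_smul, smul_eq_mul]
    by_cases hz : entry k p q x = 0
    · rw [hz, mul_zero, mul_zero]
    · rw [h k p q hz]
  · rw [central_cartan_lie, smul_eq_mk, hc, smul_zero]
  · rw [deg_lie, smul_eq_mk, hd, smul_zero]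

lemma exists_mem_rootSpace_of_entry_ne_zero (hI : ambient I ≤ affineNilPlus n) {k : ℤ}
    {p q : Idx n} {x : AffineB n} (hx : x ∈ ambient I) (hne : entry k p q x ≠ 0) :
    ∃ y ∈ ambient I, y ∈ affineRootSpace n (entryWeight k p q) ∧ entry k p q y ≠ 0 := by
  classical
  obtain ⟨s, hs⟩ := exists_finset_coeff_eq_zero x
  obtain ⟨y, hy, hy1, hy2, hy3⟩ := exists_mem_ambient_entry_eq_zero (k := k) (p := p) (q := q)
    ((s ×ˢ (Finset.univ : Finset (Idx n × Idx n))).filter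
      fun e => entryWeight e.1 e.2.1 e.2.2 ≠ entryWeight k p q)
    (fun e he => (Finset.mem_filter.mp he).2) hx hne
  obtain ⟨hc, hd, -, -⟩ := mem_affineNilPlus_iff.mp (hI hy)
  refine ⟨y, hy, mem_rootSpace_of_entry hc hd fun m a b h => ?_, hy1⟩
  contrapose! h
  by_cases hm : m ∈ s
  · exact hy2 (m, a, b) (by simp [hm, h])
  · exact hy3 m a b (by rw [entry_eq, hs m hm]; rfl)

lemma entryWeight_ne_zero (k : ℤ) {p q : Idx n} (hpq : p ≠ q) : entryWeight k p q ≠ 0 := by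
  intro h
  have h0 : entryWeight k p q = entryWeight 0 p p := by rw [h, entryWeight_self]; simp
  obtain ⟨-, ⟨h, -⟩ | ⟨-, h⟩ | ⟨h1, h2⟩⟩ := eq_or_of_entryWeight_eq h0
  · exact hpq h
  · exact hpq h
  · exact hpq (opp_injective (h2.symm.trans h1))

lemma eq_zero_of_mem_rootSpace {k : ℤ} {p q : Idx n} (hpq : p ≠ q) {x : AffineB n}
    (hx : x ∈ affineRootSpace n (entryWeight k p q)) (h0 : entry k p q x = 0) : x = 0 := by
  obtain ⟨hc, hd⟩ := central_deg_of_mem_rootSpace (entryWeight_ne_zero k hpq) hx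
  refine ext_entry (fun m a b => ?_) (by rw [hc]; rfl) (by rw [hd]; rfl)
  rw [map_zero]
  by_contra hne
  obtain ⟨rfl, ⟨h, -⟩ | ⟨rfl, rfl⟩ | ⟨rfl, rfl⟩⟩ :=
    eq_or_of_entryWeight_eq (eq_entryWeight_of_entry_ne_zero hx hne)
  · exact hpq h
  · exact hne h0
  · exact hne ((apply_opp_opp_eq_zero_iff _ _ _).mpr h0)

lemma eq_smul_rootVec_of_mem_rootSpace {k : ℤ} {p q : Idx n} (hpq : p ≠ q) (hq : q ≠ opp p)
    {x : AffineB n} (hx : x ∈ affineRootSpace n (entryWeight k p q)) :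
    x = (entry k p q x / entry k p q (rootVec k p q)) • rootVec k p q := by
  have hsmul := (affineRootSpace n (entryWeight k p q)).smul_mem
    (entry k p q x / entry k p q (rootVec k p q)) (rootVec_mem_rootSpace k p q)
  have hsub := (affineRootSpace n (entryWeight k p q)).sub_mem hx hsmul
  refine sub_eq_zero.mp (eq_zero_of_mem_rootSpace hpq hsub ?_)
  rw [map_sub, map_smul, smul_eq_mul, div_mul_cancel₀ _ (entry_rootVec_self k hq), sub_self]

lemma rootVec_mem_ambient_of_entry_ne_zero (hI : ambient I ≤ affineNilPlus n) {k : ℤ} {p q : Idx n}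
    (hpq : p ≠ q) {x : AffineB n} (hx : x ∈ ambient I) (hne : entry k p q x ≠ 0) :
    rootVec k p q ∈ ambient I := by
  obtain ⟨y, hy, hyr, hy1⟩ := exists_mem_rootSpace_of_entry_ne_zero hI hx hne
  have hq : q ≠ opp p := fun h => basisPos_add_ne_of_apply_ne_zero hne (eq_opp_iff.mp h)
  rw [eq_smul_rootVec_of_mem_rootSpace hpq hq hyr] at hy
  exact (Submodule.smul_mem_iff _ (div_ne_zero hy1 (entry_rootVec_self k hq))).mp hy

lemma mem_of_rootVec_mem {W : Submodule ℂ (AffineB n)} {x : AffineB n} (hc : x.central = 0)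
    (hd : x.deg = 0) (h : ∀ k p q, entry k p q x ≠ 0 → rootVec k p q ∈ W) : x ∈ W := by
  obtain ⟨s, hs⟩ := exists_finset_coeff_eq_zero x
  rw [eq_sum_monomial hc hd hs]
  refine Submodule.sum_mem _ fun k _ => ?_
  rw [eq_sum_rootMat (coeff k x), monomial_smul, monomial_sum]
  refine Submodule.smul_mem _ _ (Submodule.sum_mem _ fun p _ => ?_)
  rw [monomial_sum]
  refine Submodule.sum_mem _ fun q _ => ?_
  rw [monomial_smul]
  by_cases hne : (coeff k x).1 p q = 0
  · rw [hne, zero_div, zero_smul]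
    exact zero_mem _
  · exact Submodule.smul_mem _ _ (h k p q hne)

lemma rootVec_mem_affineBorel {k : ℤ} {p q : Idx n}
    (h : 0 < k ∨ (k = 0 ∧ basisPos p < basisPos q)) : rootVec k p q ∈ affineBorel n :=
  affineNilPlus_le_affineBorel (rootVec_mem_affineNilPlus h)

lemma rootVec_mem_ambient_left {k m j : ℤ} (hj : k + m = j) {p q r : Idx n}
    (hb : 0 < k ∨ (k = 0 ∧ basisPos p < basisPos q)) (hm : 0 ≤ m) (h : rootVec m q r ∈ ambient I)
    (hqr : q ≠ opp r) (hqp : q ≠ opp p) (hpr : p ≠ r) : rootVec j p r ∈ ambient I := by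
  have h1 := lie_mem_ambient (rootVec_mem_affineBorel hb) h
  rwa [rootVec_lie k m (by lia) hqr hqp hpr, hj,
    Submodule.smul_mem_iff _ (formValue_ne_zero q)] at h1

lemma rootVec_mem_ambient_right {k m j : ℤ} (hj : k + m = j) {p q r : Idx n} (hk : 0 ≤ k)
    (h : rootVec k p q ∈ ambient I) (hb : 0 < m ∨ (m = 0 ∧ basisPos q < basisPos r))
    (hqr : q ≠ opp r) (hqp : q ≠ opp p) (hpr : p ≠ r) : rootVec j p r ∈ ambient I := by
  have h1 := lie_mem_ambient_left h (rootVec_mem_affineBorel hb)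
  rwa [rootVec_lie k m (by lia) hqr hqp hpr, hj,
    Submodule.smul_mem_iff _ (formValue_ne_zero q)] at h1

lemma lie_rootMat_apply_self {p q : Idx n} (hp : p ≠ opp p) (hq : q ≠ opp p) (hpq : p ≠ q) :
    (⁅rootMat p q, rootMat q p⁆ : SoB n).1 p p ≠ 0 := by
  have hqp : p ≠ opp q := fun h => hq (by rw [h, opp_opp])
  rw [coe_lie_apply, Finset.sum_eq_single q, Finset.sum_eq_zero, sub_zero, rootMat_apply_self hq,
    rootMat_apply_self hqp]
  · exact mul_ne_zero (formValue_ne_zero _) (formValue_ne_zero _)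
  · intro r _
    rw [rootMat_apply_of_ne (a := p) (b := r), zero_mul]
    · rintro ⟨h, -⟩; exact hpq h.symm
    · rintro ⟨h, -⟩; exact hp h.symm
  · intro r _ hr
    rw [rootMat_apply_of_ne (p := p) (q := q), zero_mul]
    · rintro ⟨-, h⟩; exact hr h.symm
    · rintro ⟨h, -⟩; exact hqp h.symm
  · simp

lemma entry_lie_rootVec_self {p q : Idx n} (hp : p ≠ opp p) (hq : q ≠ opp p) (hpq : p ≠ q)
    {k m : ℤ} : entry (k + m) p p ⁅rootVec k p q, rootVec m q p⁆ ≠ 0 := by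
  rw [rootVec, rootVec, monomial_lie_monomial, map_add, map_smul, entry_eq, coeff_monomial,
    if_pos rfl, entry_eq, coeff_c]
  simpa using lie_rootMat_apply_self hp hq hpq

lemma rootSpace_delta_le_of_entry_ne_zero (hn : 0 < n) (hI : IsCombinatorialIdeal I) {p : Idx n}
    {x : AffineB n} (hx : x ∈ ambient I) (hne : entry 1 p p x ≠ 0) :
    affineRootSpace n (delta n) ≤ ambient I := by
  refine (hI.2.2 _ (isPosRoot_delta hn)).elim (fun h => ?_) inf_eq_right.mp
  obtain ⟨y, hy, hyδ, hy1⟩ := exists_mem_rootSpace_of_entry_ne_zero hI.1 hx hne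
  rw [← delta_eq_entryWeight] at hyδ
  have hy0 : y ∈ ambient I ⊓ affineRootSpace n (delta n) := ⟨hy, hyδ⟩
  rw [h, Submodule.mem_bot] at hy0
  exact absurd (by rw [hy0, map_zero]) hy1

lemma rootSpace_delta_le (hn : 0 < n) (hI : IsBasicIdeal I) :
    affineRootSpace n (delta n) ≤ ambient I := by
  obtain ⟨hI, β, ⟨-, hβI⟩, (rfl | hγ) | ⟨γ, hγ, rfl⟩⟩ := hI
  · exact hβI
  all_goals
    obtain ⟨p, q, rfl, hpq, hq, hp⟩ := exists_entryWeight_of_mem_finPosRoots hγ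
    have hne : p ≠ q := by rintro rfl; lia
    refine rootSpace_delta_le_of_entry_ne_zero hn hI ?_
      (entry_lie_rootVec_self hp hq hne (k := 0) (m := 1))
  · exact lie_mem_ambient_left (hβI (rootVec_mem_rootSpace 0 p q))
      (rootVec_mem_affineBorel (Or.inl one_pos))
  · have hsub : delta n - entryWeight 0 p q = entryWeight 1 q p := by
      simp only [entryWeight, Int.cast_zero, Int.cast_one, zero_smul, one_smul]
      abel
    rw [hsub] at hβI
    exact lie_mem_ambient (rootVec_mem_affineBorel (Or.inr ⟨rfl, hpq⟩))
      (hβI (rootVec_mem_rootSpace 1 q p))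

lemma rootVec_opp_eq_zero (k : ℤ) (p : Idx n) : rootVec k p (opp p) = 0 := by
  have h := rootVec_opp_opp k p (opp p)
  rw [opp_opp, eq_neg_iff_add_eq_zero, ← two_smul ℂ] at h
  exact (smul_eq_zero.mp h).resolve_left two_ne_zero

lemma rootVec_lie_middle {a b : ℤ} (hab : a + b ≠ 0) {p : Idx n} (hp : p ≠ Sum.inl ()) :
    ⁅rootVec a p (Sum.inl ()), rootVec b (Sum.inl ()) p⁆ = (2 : ℂ) • rootVec (a + b) p p := by
  rw [rootVec, rootVec, monomial_lie_monomial, rootMat_lie_middle hp, monomial_smul, if_neg hab,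
    zero_smul, add_zero, rootVec]

lemma eq_opp_self_iff {p : Idx n} : p = opp p ↔ p = Sum.inl () := by
  rcases p with _ | _ | _ <;> simp [opp]

section DeltaMem

variable (hI : affineRootSpace n (delta n) ≤ ambient I)
include hI

lemma rootVec_one_self_mem (p : Idx n) : rootVec 1 p p ∈ ambient I := hI (by
  rw [delta_eq_entryWeight p]
  exact rootVec_mem_rootSpace 1 p p)

lemma rootVec_mem_of_delta_of_ne {k : ℤ} {p q : Idx n} (hpq : p ≠ q)
    (hk : 2 ≤ k ∨ (k = 1 ∧ basisPos p < basisPos q)) : rootVec k p q ∈ ambient I := by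
  by_cases hq : q = opp p
  · rw [hq, rootVec_opp_eq_zero]
    exact zero_mem _
  have hk' : 0 < k - 1 ∨ (k - 1 = 0 ∧ basisPos p < basisPos q) := by lia
  by_cases hp : p = opp p
  · have hq' : q ≠ opp q := fun h => hpq
      ((eq_opp_self_iff.mp hp).trans (eq_opp_self_iff.mp h).symm)
    exact rootVec_mem_ambient_left (k := k - 1) (m := 1) (by lia) hk' (by lia)
      (rootVec_one_self_mem hI q) hq' hq hpq
  · exact rootVec_mem_ambient_right (k := 1) (m := k - 1) (by lia) (by lia)
      (rootVec_one_self_mem hI p) hk' (fun h => hq (by rw [h, opp_opp])) hp hpq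

lemma rootVec_self_mem_of_delta {k : ℤ} (hk : 2 ≤ k) (p : Idx n) : rootVec k p p ∈ ambient I := by
  by_cases hp : p = Sum.inl ()
  · subst hp
    have h0 : rootVec k (Sum.inl () : Idx n) (Sum.inl ()) = 0 := rootVec_opp_eq_zero k (Sum.inl ())
    rw [h0]
    exact zero_mem _
  refine (Submodule.smul_mem_iff _ (two_ne_zero (α := ℂ))).mp ?_
  rcases lt_or_gt_of_ne (basisPos_injective.ne hp) with h | h
  · rw [show k = 1 + (k - 1) by lia, ← rootVec_lie_middle (by lia) hp]
    exact lie_mem_ambient_left (rootVec_mem_of_delta_of_ne hI hp (Or.inr ⟨rfl, h⟩))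
      (rootVec_mem_affineBorel (Or.inl (by lia)))
  · rw [show k = k - 1 + 1 by lia, ← rootVec_lie_middle (by lia) hp]
    exact lie_mem_ambient (rootVec_mem_affineBorel (Or.inl (by lia)))
      (rootVec_mem_of_delta_of_ne hI (Ne.symm hp) (Or.inr ⟨rfl, h⟩))

lemma rootVec_mem_of_delta_of_le {k : ℤ} {p q : Idx n}
    (hk : 2 ≤ k ∨ (k = 1 ∧ basisPos p ≤ basisPos q)) : rootVec k p q ∈ ambient I := by
  by_cases hpq : p = q
  · subst hpq
    rcases hk with hk | ⟨rfl, -⟩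
    · exact rootVec_self_mem_of_delta hI hk p
    · exact rootVec_one_self_mem hI p
  · exact rootVec_mem_of_delta_of_ne hI hpq
      (hk.imp_right fun h => ⟨h.1, h.2.lt_of_ne (basisPos_injective.ne hpq)⟩)

end DeltaMem

/-- The positions in `posRootPositions` whose pair of basis vectors satisfies `P`; this turns
conditions on root vectors into sets of positive roots. -/
def rootPositions (P : Idx n → Idx n → Prop) : Set (ℕ × ℕ) :=
  {x ∈ posRootPositions n | ∃ p q : Idx n, basisPos p = x.1 ∧ basisPos q = x.2 ∧ P p q}

lemma mem_rootPositions {P : Idx n → Idx n → Prop} {p q : Idx n} :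
    (basisPos p, basisPos q) ∈ rootPositions P ↔
      (basisPos p, basisPos q) ∈ posRootPositions n ∧ P p q := by
  refine and_congr_right fun _ => ⟨?_, fun h => ⟨p, q, rfl, rfl, h⟩⟩
  rintro ⟨p', q', hp, hq, h⟩
  rwa [← basisPos_injective hp, ← basisPos_injective hq]

lemma isUpper_rootPositions {P : Idx n → Idx n → Prop}
    (hrow : ∀ p' p q, basisPos p' < basisPos p → basisPos p < basisPos q →
      basisPos p + basisPos q < 2 * n → P p q → P p' q)
    (hcol : ∀ p q q', basisPos p < basisPos q → basisPos q' = basisPos q + 1 →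
      basisPos p + basisPos q' < 2 * n → P p q → P p q') : IsUpper n (rootPositions P) := by
  refine ⟨fun _ hx => hx.1, fun {_ _ _ _} hA ht hj hr => ?_⟩
  obtain ⟨⟨h1, h2⟩, p, q, rfl, rfl, hP⟩ := hA
  obtain ⟨p', q', h⟩ := exists_idx_of_mem_posRootPositions ht
  obtain ⟨rfl, rfl⟩ := Prod.mk.inj h
  obtain ⟨h3, h4⟩ := ht
  simp only at h1 h2 h3 h4
  refine mem_rootPositions.mpr ⟨⟨h3, h4⟩, ?_⟩
  have hP' : P p' q := by
    rcases hj.eq_or_lt with hj | hj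
    · rwa [basisPos_injective hj]
    · exact hrow p' p q hj h1 h2 hP
  suffices h : ∀ c, basisPos q ≤ c → ∀ q', basisPos q' = c → basisPos p' + c < 2 * n → P p' q' from
    h _ hr q' rfl h4
  intro c hc
  induction c, hc using Nat.le_induction with
  | base => exact fun q' hq' _ => basisPos_injective hq' ▸ hP'
  | succ c hc ih =>
    intro q' hq' hlt
    obtain ⟨b, rfl⟩ := exists_basisPos_eq (n := n) (k := c) (by lia)
    exact hcol p' b q' (by lia) hq' (by lia) (ih b rfl (by lia))

lemma symmMem_rootPositions_iff {P : Idx n → Idx n → Prop}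
    (hP : ∀ p q, P (opp q) (opp p) ↔ P p q) {p q : Idx n} :
    SymmMem n (rootPositions P) (basisPos p) (basisPos q) ↔
      basisPos p < basisPos q ∧ basisPos p + basisPos q ≠ 2 * n ∧ P p q := by
  have hp := basisPos_le p
  have hq := basisPos_le q
  unfold SymmMem
  rw [← basisPos_opp, ← basisPos_opp, mem_rootPositions, mem_rootPositions, hP, basisPos_opp,
    basisPos_opp]
  simp only [posRootPositions, Set.mem_ofPred_eq]
  by_cases h : P p q
  · simp only [h, and_true]
    lia
  · simp only [h, and_false, or_self]

/-- The positive roots of `B_n` in the support of an ideal, as positions. -/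
def supportRoots (I : LieIdeal ℂ (affineBorel n)) : Set (ℕ × ℕ) :=
  rootPositions fun p q => rootVec 0 p q ∈ ambient I

/-- The positive roots `γ` of `B_n` with `δ - γ` not in the support of an ideal, as positions. -/
def missingRoots (I : LieIdeal ℂ (affineBorel n)) : Set (ℕ × ℕ) :=
  rootPositions fun p q => rootVec 1 q p ∉ ambient I

lemma ne_opp_of_basisPos_add_ne {p q : Idx n} (h : basisPos p + basisPos q ≠ 2 * n) : p ≠ opp q :=
  fun hp => h (by rw [add_comm]; exact eq_opp_iff.mp hp)

lemma isUpper_supportRoots : IsUpper n (supportRoots I) := by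
  refine isUpper_rootPositions (fun p' p q _ _ _ h => ?_) (fun p q q' _ _ _ h => ?_)
  · exact rootVec_mem_ambient_left (add_zero 0) (Or.inr ⟨rfl, by lia⟩) le_rfl h
      (ne_opp_of_basisPos_add_ne (by lia)) (ne_opp_of_basisPos_add_ne (by lia))
      (ne_of_apply_ne basisPos (by lia))
  · exact rootVec_mem_ambient_right (add_zero 0) le_rfl h (Or.inr ⟨rfl, by lia⟩)
      (ne_opp_of_basisPos_add_ne (by lia)) (ne_opp_of_basisPos_add_ne (by lia))
      (ne_of_apply_ne basisPos (by lia))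

lemma isUpper_missingRoots : IsUpper n (missingRoots I) := by
  refine isUpper_rootPositions (fun p' p q _ _ _ => mt fun h => ?_)
    (fun p q q' _ _ _ => mt fun h => ?_)
  · exact rootVec_mem_ambient_right (add_zero 1) (by lia) h (Or.inr ⟨rfl, by lia⟩)
      (ne_opp_of_basisPos_add_ne (by lia)) (ne_opp_of_basisPos_add_ne (by lia))
      (ne_of_apply_ne basisPos (by lia))
  · exact rootVec_mem_ambient_left (zero_add 1) (Or.inr ⟨rfl, by lia⟩) (by lia) h
      (ne_opp_of_basisPos_add_ne (by lia)) (ne_opp_of_basisPos_add_ne (by lia))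
      (ne_of_apply_ne basisPos (by lia))

-- The roots at `(i, j)` and `(k, 2 * n - j)` add up to a root, so `δ` minus the second is obtained
-- by bracketing the root vector of the first with an element of degree one.
lemma notMem_missingRoots_of_mem_supportRoots {i j k l : ℕ} (h : (i, j) ∈ supportRoots I)
    (hik : i ≠ k) (hjl : j + l = 2 * n) : (k, l) ∉ missingRoots I := by
  rintro ⟨⟨h1, h2⟩, a, b, rfl, rfl, hb⟩
  obtain ⟨⟨h3, h4⟩, p, q, rfl, rfl, hq⟩ := h
  simp only at h1 h2 h3 h4
  obtain rfl : b = opp q := eq_opp_iff.mpr hjl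
  have ha := basisPos_opp a
  have hmem : rootVec 1 (opp a) q ∈ ambient I :=
    rootVec_mem_ambient_left (add_zero 1) (Or.inl one_pos) le_rfl hq
      (ne_opp_of_basisPos_add_ne (by lia)) (ne_opp_of_basisPos_add_ne (by lia))
      (ne_of_apply_ne basisPos (by lia))
  apply hb
  rw [← neg_mem_iff, ← rootVec_opp_opp, opp_opp]
  exact hmem

lemma isCommutingPair_roots : IsCommutingPair n (supportRoots I) (missingRoots I) where
  left := isUpper_supportRoots
  right := isUpper_missingRoots
  not_left _ _ _ hA := notMem_missingRoots_of_mem_supportRoots hA zero_ne_one (by lia)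
  not_right _ _ _ hC hA := notMem_missingRoots_of_mem_supportRoots hA one_ne_zero (by lia) hC

lemma symmMem_supportRoots_iff {p q : Idx n} :
    SymmMem n (supportRoots I) (basisPos p) (basisPos q) ↔
      basisPos p < basisPos q ∧ basisPos p + basisPos q ≠ 2 * n ∧ rootVec 0 p q ∈ ambient I :=
  symmMem_rootPositions_iff fun p q => by rw [rootVec_opp_opp, neg_mem_iff]

lemma symmMem_missingRoots_iff {p q : Idx n} :
    SymmMem n (missingRoots I) (basisPos p) (basisPos q) ↔
      basisPos p < basisPos q ∧ basisPos p + basisPos q ≠ 2 * n ∧ rootVec 1 q p ∉ ambient I :=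
  symmMem_rootPositions_iff fun p q => by rw [rootVec_opp_opp, neg_mem_iff]

lemma ambient_le_pairSubmodule (hI : ambient I ≤ affineNilPlus n) :
    ambient I ≤ pairSubmodule n (supportRoots I) (missingRoots I) := by
  intro x hx
  refine mem_pairSubmodule.mpr ⟨hI hx, fun k p q hne => ?_⟩
  obtain ⟨-, -, hneg, hupper⟩ := mem_affineNilPlus_iff.mp (hI hx)
  rcases (show k < 0 ∨ k = 0 ∨ k = 1 ∨ 2 ≤ k by lia) with hk | rfl | rfl | hk
  · exact absurd (by rw [entry_eq, hneg k hk]; rfl) hne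
  · have hpq : basisPos p < basisPos q := lt_of_not_ge fun h => hne (hupper p q h)
    exact isAllowed_zero_iff.mpr (symmMem_supportRoots_iff.mpr
      ⟨hpq, basisPos_add_ne_of_apply_ne_zero hne,
        rootVec_mem_ambient_of_entry_ne_zero hI (ne_of_apply_ne basisPos hpq.ne) hx hne⟩)
  · refine isAllowed_one_iff.mpr fun h => ?_
    obtain ⟨hqp, -, hmem⟩ := symmMem_missingRoots_iff.mp h
    exact hmem (rootVec_mem_ambient_of_entry_ne_zero hI (ne_of_apply_ne basisPos hqp.ne') hx hne)
  · exact Or.inl hk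

lemma pairSubmodule_le_ambient (hI : affineRootSpace n (delta n) ≤ ambient I) :
    pairSubmodule n (supportRoots I) (missingRoots I) ≤ ambient I := by
  intro x hx
  obtain ⟨hxN, hxallowed⟩ := mem_pairSubmodule.mp hx
  obtain ⟨hc, hd, -, -⟩ := mem_affineNilPlus_iff.mp hxN
  refine mem_of_rootVec_mem hc hd fun k p q hne => ?_
  rcases hxallowed k p q hne with hk | ⟨rfl, hk⟩ | ⟨rfl, hk⟩
  · exact rootVec_mem_of_delta_of_le hI (Or.inl hk)
  · rcases le_or_gt (basisPos p) (basisPos q) with h | h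
    · exact rootVec_mem_of_delta_of_le hI (Or.inr ⟨rfl, h⟩)
    · have hs := basisPos_add_ne_of_apply_ne_zero hne
      exact not_not.mp fun hr => hk (symmMem_missingRoots_iff.mpr ⟨h, by lia, hr⟩)
  · exact (symmMem_supportRoots_iff.mp hk).2.2

lemma ambient_eq_pairSubmodule (hn : 0 < n) (hI : IsBasicIdeal I) :
    ambient I = pairSubmodule n (supportRoots I) (missingRoots I) :=
  le_antisymm (ambient_le_pairSubmodule hI.1.1)
    (pairSubmodule_le_ambient (rootSpace_delta_le hn hI))

lemma bijOn_supportRoots_missingRoots (hn : 0 < n) :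
    Set.BijOn (fun I : LieIdeal ℂ (affineBorel n) => (supportRoots I, missingRoots I))
      {I | IsBasicIdeal I} {x | IsCommutingPair n x.1 x.2} := by
  refine ⟨fun I _ => isCommutingPair_roots, fun I hI J hJ h => ?_, fun x hx => ?_⟩
  · obtain ⟨hA, hC⟩ := Prod.mk.inj h
    apply ambient_injective
    rw [ambient_eq_pairSubmodule hn hI, ambient_eq_pairSubmodule hn hJ, hA, hC]
  · have hb := isBasicIdeal_pairIdeal hn hx
    obtain ⟨hA, hC⟩ := pair_eq_of_pairSubmodule_eq (isCommutingPair_roots (I := pairIdeal hx)) hx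
      ((ambient_eq_pairSubmodule hn hb).symm.trans (ambient_pairIdeal hx))
    exact ⟨pairIdeal hx, hb, Prod.ext hA hC⟩

/-! ### Counting commuting pairs -/

/-- The upper sets with `k` roots in the first row; these are then the roots in the last `k` of the
columns `q < 2 * n`. -/
def upperSetsWithRow (n k : ℕ) : Set (Set (ℕ × ℕ)) :=
  {A | IsUpper n A ∧ k ≤ 2 * n - 1 ∧ ∀ q, (0, q) ∈ A ↔ 2 * n ≤ q + k ∧ q < 2 * n}

lemma exists_mem_upperSetsWithRow (h : IsUpper n A) : ∃ k, A ∈ upperSetsWithRow n k := by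
  classical
  by_cases he : ∃ q, (0, q) ∈ A
  · have hs := Nat.find_spec he
    obtain ⟨h1, h2⟩ := h.subset hs
    simp only at h1 h2
    refine ⟨2 * n - Nat.find he, h, by lia, fun q => ⟨fun hq => ?_, fun hq => ?_⟩⟩
    · have h3 := Nat.find_min' he hq
      have h4 := (h.subset hq).2
      simp only at h4
      lia
    · exact h.mem_of_le hs ⟨by simp only; lia, by simp only; lia⟩ le_rfl (by lia)
  · exact ⟨0, h, Nat.zero_le _, fun q => ⟨fun hq => absurd ⟨q, hq⟩ he, fun hq => by lia⟩⟩

lemma eq_of_mem_upperSetsWithRow {j k : ℕ} (hj : A ∈ upperSetsWithRow n j)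
    (hk : A ∈ upperSetsWithRow n k) : j = k := by
  obtain ⟨-, hj1, hj2⟩ := hj
  obtain ⟨-, hk1, hk2⟩ := hk
  have h1 := (hj2 (2 * n - k)).symm.trans (hk2 (2 * n - k))
  have h2 := (hj2 (2 * n - j)).symm.trans (hk2 (2 * n - j))
  lia

lemma isUpper_zero_iff : IsUpper 0 A ↔ A = ∅ := by
  refine ⟨fun h => Set.eq_empty_of_forall_notMem fun x hx => ?_, ?_⟩
  · have := (h.subset hx).2
    lia
  · rintro rfl
    exact ⟨Set.empty_subset _, fun h => h.elim⟩

lemma upperSetsWithRow_zero_zero : upperSetsWithRow 0 0 = {∅} := by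
  ext A
  refine ⟨fun h => isUpper_zero_iff.mp h.1, ?_⟩
  rintro rfl
  exact ⟨isUpper_zero_iff.mpr rfl, le_rfl, by simp⟩

lemma upperSetsWithRow_eq_empty {k : ℕ} (hk : 2 * n - 1 < k) : upperSetsWithRow n k = ∅ :=
  Set.eq_empty_of_forall_notMem fun _ hA => hk.not_ge hA.2.1

/-- Deletes the first row of a set of roots of `B_{n+1}`, which leaves a set of roots of `B_n`. -/
def dropRow (A : Set (ℕ × ℕ)) : Set (ℕ × ℕ) := {x | (x.1 + 1, x.2 + 1) ∈ A}

lemma mem_dropRow {i q : ℕ} : (i, q) ∈ dropRow A ↔ (i + 1, q + 1) ∈ A := Iff.rfl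

lemma succ_mem_posRootPositions {i q : ℕ} :
    (i + 1, q + 1) ∈ posRootPositions (n + 1) ↔ (i, q) ∈ posRootPositions n := by
  simp only [posRootPositions, Set.mem_ofPred_eq]
  lia

lemma isUpper_dropRow (h : IsUpper (n + 1) A) : IsUpper n (dropRow A) where
  subset _ hx := succ_mem_posRootPositions.mp (h.subset hx)
  mem_of_le hA ht hi hq := h.mem_of_le (mem_dropRow.mp hA) (succ_mem_posRootPositions.mpr ht)
    (by lia) (by lia)

/-- Puts a first row with `k` roots on top of a set of roots of `B_n`. -/
def addRow (n k : ℕ) (B : Set (ℕ × ℕ)) : Set (ℕ × ℕ) :=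
  {x | x.1 = 0 ∧ 2 * (n + 1) ≤ x.2 + k ∧ x.2 < 2 * (n + 1)} ∪ {x | 0 < x.1 ∧ 0 < x.2 ∧
    (x.1 - 1, x.2 - 1) ∈ B}

section AddRow

variable {k i q : ℕ} {B : Set (ℕ × ℕ)}

lemma zero_mem_addRow : (0, q) ∈ addRow n k B ↔ 2 * (n + 1) ≤ q + k ∧ q < 2 * (n + 1) := by
  simp [addRow]

lemma succ_mem_addRow : (i + 1, q + 1) ∈ addRow n k B ↔ (i, q) ∈ B := by
  simp [addRow]

lemma succ_zero_notMem_addRow : (i + 1, 0) ∉ addRow n k B := by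
  simp [addRow]

lemma dropRow_addRow : dropRow (addRow n k B) = B :=
  Set.ext fun _ => mem_dropRow.trans succ_mem_addRow

end AddRow

/-- The upper sets with fewer than `k` roots in the first row, or none. They are the upper sets on
top of which a first row with `k` roots can be put: the second row of an upper set is shorter than
the first, unless both are empty. -/
def smallUpperSets (n k : ℕ) : Set (Set (ℕ × ℕ)) :=
  ⋃ j ∈ Finset.range (max k 1), upperSetsWithRow n j

lemma mem_smallUpperSets {k : ℕ} :
    A ∈ smallUpperSets n k ↔ ∃ j < max k 1, A ∈ upperSetsWithRow n j := by
  simp [smallUpperSets]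

lemma dropRow_mem_smallUpperSets {k : ℕ} (hA : A ∈ upperSetsWithRow (n + 1) k) :
    dropRow A ∈ smallUpperSets n k := by
  obtain ⟨hA, -, hrow⟩ := hA
  obtain ⟨j, hj⟩ := exists_mem_upperSetsWithRow (isUpper_dropRow hA)
  refine mem_smallUpperSets.mpr ⟨j, ?_, hj⟩
  by_cases hj0 : j = 0
  · lia
  obtain ⟨-, hj1, hj2⟩ := hj
  have hsecond := mem_dropRow.mp ((hj2 (2 * n - j)).mpr ⟨by lia, by lia⟩)
  have hfirst := (hrow _).mp (hA.mem_of_le (j := 0) hsecond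
    ⟨by simp only; lia, by simp only; lia⟩ (by lia) le_rfl)
  lia

lemma injOn_dropRow (k : ℕ) : Set.InjOn dropRow (upperSetsWithRow (n + 1) k) := by
  rintro A ⟨hA, -, hA0⟩ B ⟨hB, -, hB0⟩ hAB
  ext ⟨i, q⟩
  rcases i with _ | i
  · rw [hA0, hB0]
  · rcases q with _ | q
    · exact iff_of_false (fun h => Nat.not_lt_zero _ (hA.subset h).1)
        fun h => Nat.not_lt_zero _ (hB.subset h).1
    · rw [← mem_dropRow, ← mem_dropRow, hAB]

lemma addRow_subset {k : ℕ} {B : Set (ℕ × ℕ)} (hk : k ≤ 2 * n + 1) (hB : IsUpper n B) :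
    addRow n k B ⊆ posRootPositions (n + 1) := by
  rintro ⟨i, q⟩ hx
  rcases i with _ | i
  · rw [zero_mem_addRow] at hx
    exact ⟨by simp only; lia, by simp only; lia⟩
  · rcases q with _ | q
    · exact absurd hx succ_zero_notMem_addRow
    · exact succ_mem_posRootPositions.mpr (hB.subset (succ_mem_addRow.mp hx))

lemma isUpper_addRow {k : ℕ} {B : Set (ℕ × ℕ)} (hk : k ≤ 2 * n + 1) (hB : B ∈ smallUpperSets n k) :
    IsUpper (n + 1) (addRow n k B) := by
  obtain ⟨j, hj, hB, -, hrow⟩ := mem_smallUpperSets.mp hB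
  refine ⟨addRow_subset hk hB, fun {i q i' q'} hx ht hi hq => ?_⟩
  have ht1 := ht.1
  have ht2 := ht.2
  simp only at ht1 ht2
  rcases i with _ | i
  · obtain rfl : i' = 0 := by lia
    rw [zero_mem_addRow] at hx ⊢
    lia
  rcases q with _ | q
  · exact absurd hx succ_zero_notMem_addRow
  rw [succ_mem_addRow] at hx
  obtain ⟨q', rfl⟩ : ∃ r, q' = r + 1 := ⟨q' - 1, by lia⟩
  rcases i' with _ | i'
  · obtain ⟨h1, h2⟩ := hB.subset hx
    simp only at h1 h2
    have hq0 := (hrow q).mp (hB.mem_of_le hx ⟨by simp only; lia, by simp only; lia⟩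
      (Nat.zero_le _) le_rfl)
    rw [zero_mem_addRow]
    lia
  · rw [succ_mem_addRow]
    exact hB.mem_of_le hx (succ_mem_posRootPositions.mp ht) (by lia) (by lia)

lemma bijOn_dropRow {k : ℕ} (hk : k ≤ 2 * n + 1) :
    Set.BijOn dropRow (upperSetsWithRow (n + 1) k) (smallUpperSets n k) :=
  ⟨fun _ => dropRow_mem_smallUpperSets, injOn_dropRow k, fun B hB =>
    ⟨addRow n k B, ⟨isUpper_addRow hk hB, by lia, fun _ => zero_mem_addRow⟩, dropRow_addRow⟩⟩

/-- The number of upper sets of the root poset of `B_n` with `k` roots in the first row. -/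
def upperCount : ℕ → ℕ → ℕ
  | 0, k => if k = 0 then 1 else 0
  | n + 1, k => if k ≤ 2 * n + 1 then ∑ j ∈ Finset.range (max k 1), upperCount n j else 0

lemma encard_smallUpperSets_eq_sum (n k : ℕ) : (smallUpperSets n k).encard =
    ∑ j ∈ Finset.range (max k 1), (upperSetsWithRow n j).encard :=
  encard_biUnion_finset _ fun _ _ _ _ hij => Set.disjoint_left.mpr fun _ hi hj =>
    hij (eq_of_mem_upperSetsWithRow hi hj)

lemma encard_upperSetsWithRow (n k : ℕ) : (upperSetsWithRow n k).encard = upperCount n k := by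
  induction n generalizing k with
  | zero =>
    rcases k with _ | k
    · simp [upperSetsWithRow_zero_zero, upperCount]
    · simp [upperSetsWithRow_eq_empty, upperCount]
  | succ n ih =>
    rw [upperCount]
    split_ifs with hk
    · rw [Set.encard_congr (bijOn_dropRow hk).equiv, encard_smallUpperSets_eq_sum, Nat.cast_sum]
      exact Finset.sum_congr rfl fun j _ => ih j
    · rw [upperSetsWithRow_eq_empty (by lia), Set.encard_empty, Nat.cast_zero]

lemma encard_smallUpperSets {k : ℕ} (hk : k ≤ 2 * n + 1) :
    (smallUpperSets n k).encard = upperCount (n + 1) k := by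
  rw [← encard_upperSetsWithRow, Set.encard_congr (bijOn_dropRow hk).equiv]

lemma forall_secondRow_notMem_iff {j k : ℕ} (hA : A ∈ upperSetsWithRow (n + 1) k)
    (hC : dropRow C ∈ upperSetsWithRow n j) :
    (∀ p, 2 ≤ p → p ≤ 2 * (n + 1) - 2 → (0, 2 * (n + 1) - p) ∈ A → (1, p) ∉ C) ↔
      j < max (2 * n + 1 - k) 1 := by
  obtain ⟨-, hk, hA⟩ := hA
  obtain ⟨-, hj, hC⟩ := hC
  constructor
  · intro h
    by_contra! hlt
    refine h (2 * n + 1 - j) (by lia) (by lia) ((hA _).mpr (by lia)) ?_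
    have := mem_dropRow.mp ((hC (2 * n - j)).mpr (by lia))
    rwa [show 2 * n - j + 1 = 2 * n + 1 - j by lia] at this
  · intro h p h2 _ h0 h1
    have h3 := (hA _).mp h0
    have h4 := (hC (p - 1)).mp (mem_dropRow.mpr (by rwa [show p - 1 + 1 = p by lia]))
    lia

/-- The commuting pairs with `k` and `l` roots in the first rows of the two sets. -/
def commutingPairsWithRows (n k l : ℕ) : Set (Set (ℕ × ℕ) × Set (ℕ × ℕ)) :=
  {x | IsCommutingPair n x.1 x.2 ∧ x.1 ∈ upperSetsWithRow n k ∧ x.2 ∈ upperSetsWithRow n l}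

lemma setOf_isCommutingPair_eq_biUnion (n : ℕ) :
    {x : Set (ℕ × ℕ) × Set (ℕ × ℕ) | IsCommutingPair (n + 1) x.1 x.2} =
      ⋃ y ∈ Finset.range (2 * n + 2) ×ˢ Finset.range (2 * n + 2),
        commutingPairsWithRows (n + 1) y.1 y.2 := by
  ext ⟨A, C⟩
  simp only [Set.mem_iUnion, Finset.mem_product, Finset.mem_range]
  refine ⟨fun h => ?_, fun ⟨_, _, h, _⟩ => h⟩
  obtain ⟨k, hk⟩ := exists_mem_upperSetsWithRow h.left
  obtain ⟨l, hl⟩ := exists_mem_upperSetsWithRow h.right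
  have hk' := hk.2.1
  have hl' := hl.2.1
  exact ⟨(k, l), ⟨by simp only; lia, by simp only; lia⟩, h, hk, hl⟩

-- With the first rows fixed, commuting only bounds the length of each second row.
lemma bijOn_dropRow_commutingPairsWithRows {k l : ℕ} (hk : k ≤ 2 * n + 1) (hl : l ≤ 2 * n + 1) :
    Set.BijOn (Prod.map dropRow dropRow) (commutingPairsWithRows (n + 1) k l)
      (smallUpperSets n (min k (2 * n + 1 - l)) ×ˢ smallUpperSets n (min l (2 * n + 1 - k))) := by
  refine ⟨?_, ?_, ?_⟩
  · rintro ⟨A, C⟩ ⟨h, hA, hC⟩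
    obtain ⟨i, hi, hA'⟩ := mem_smallUpperSets.mp (dropRow_mem_smallUpperSets hA)
    obtain ⟨j, hj, hC'⟩ := mem_smallUpperSets.mp (dropRow_mem_smallUpperSets hC)
    have h1 := (forall_secondRow_notMem_iff hA hC').mp h.not_left
    have h2 := (forall_secondRow_notMem_iff hC hA').mp h.not_right
    exact ⟨mem_smallUpperSets.mpr ⟨i, by lia, hA'⟩, mem_smallUpperSets.mpr ⟨j, by lia, hC'⟩⟩
  · rintro ⟨A, C⟩ ⟨_, hA, hC⟩ ⟨A', C'⟩ ⟨_, hA', hC'⟩ h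
    obtain ⟨hAA', hCC'⟩ := Prod.mk.inj h
    exact Prod.ext (injOn_dropRow k hA hA' hAA') (injOn_dropRow l hC hC' hCC')
  · rintro ⟨A', C'⟩ ⟨hA', hC'⟩
    obtain ⟨i, hi, hA'⟩ := mem_smallUpperSets.mp hA'
    obtain ⟨j, hj, hC'⟩ := mem_smallUpperSets.mp hC'
    obtain ⟨A, hA, rfl⟩ := (bijOn_dropRow hk).surjOn (mem_smallUpperSets.mpr ⟨i, by lia, hA'⟩)
    obtain ⟨C, hC, rfl⟩ := (bijOn_dropRow hl).surjOn (mem_smallUpperSets.mpr ⟨j, by lia, hC'⟩)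
    exact ⟨(A, C), ⟨⟨hA.1, hC.1, (forall_secondRow_notMem_iff hA hC').mpr (by lia),
      (forall_secondRow_notMem_iff hC hA').mpr (by lia)⟩, hA, hC⟩, rfl⟩

lemma encard_commutingPairs (n : ℕ) :
    {x : Set (ℕ × ℕ) × Set (ℕ × ℕ) | IsCommutingPair (n + 1) x.1 x.2}.encard =
      ((∑ x ∈ Finset.range (2 * n + 2) ×ˢ Finset.range (2 * n + 2),
        upperCount (n + 1) (min x.1 (2 * n + 1 - x.2)) *
          upperCount (n + 1) (min x.2 (2 * n + 1 - x.1)) : ℕ) : ℕ∞) := by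
  rw [setOf_isCommutingPair_eq_biUnion, encard_biUnion_finset, Nat.cast_sum]
  · refine Finset.sum_congr rfl fun x hx => ?_
    simp only [Finset.mem_product, Finset.mem_range] at hx
    rw [Set.encard_congr (bijOn_dropRow_commutingPairsWithRows (by lia) (by lia)).equiv,
      Set.encard_prod, encard_smallUpperSets (by lia), encard_smallUpperSets (by lia),
      Nat.cast_mul]
  · intro x _ y _ hxy
    refine Set.disjoint_left.mpr fun _ hx hy => hxy (Prod.ext ?_ ?_)
    · exact eq_of_mem_upperSetsWithRow hx.2.1 hy.2.1
    · exact eq_of_mem_upperSetsWithRow hx.2.2 hy.2.2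

/-! ### Evaluation of the count -/

section Evaluation

open Finset

lemma upperCount_eq (n k : ℕ) (hk : k ≤ 2 * n) :
    (upperCount n k : ℤ) = halfPow k - 2 * upperTail n k := by
  induction n generalizing k with
  | zero =>
    obtain rfl : k = 0 := by lia
    simp [upperCount, halfPow, upperTail]
  | succ n ih =>
    rcases k with _ | k
    · simp [upperCount, halfPow, upperTail, ih]
    rw [upperCount, halfPow_succ, upperTail_succ]
    split_ifs with hk'
    · have hterm : ∀ j ∈ range (k + 1), (upperCount n j : ℤ) = halfPow j - 2 * upperTail n j :=
        fun j hj => ih j (by rw [mem_range] at hj; lia)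
      rw [Nat.max_eq_left (by lia), Nat.cast_sum, sum_congr rfl hterm, sum_sub_distrib, ← mul_sum,
        sum_halfPow, sum_upperTail]
    · obtain rfl : k = 2 * n + 1 := by lia
      rw [chooseTail_odd, pow_succ, pow_mul]
      push_cast
      ring

-- The product of two tails vanishes because one of the two indices is at most `n + 1`.
lemma upperCount_mul_upperCount {k l : ℕ} (h : k + l ≤ 2 * n + 1) :
    (upperCount (n + 1) k : ℤ) * upperCount (n + 1) l = halfPow k * halfPow l -
      2 * (upperTail (n + 1) k * halfPow l) - 2 * (upperTail (n + 1) l * halfPow k) := by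
  have hzero : upperTail (n + 1) k * upperTail (n + 1) l = 0 := by
    rcases le_total k l with hkl | hkl
    · rw [upperTail_eq_zero (k := k) (by lia), zero_mul]
    · rw [upperTail_eq_zero (k := l) (by lia), mul_zero]
  rw [upperCount_eq _ _ (by lia), upperCount_eq _ _ (by lia)]
  linear_combination 4 * hzero

lemma sum_triangle_upperCount {M : ℕ} (hM : M ≤ 2 * n + 1) :
    2 * ∑ k ∈ range (M + 1), ∑ l ∈ range (M + 1 - k),
      (upperCount (n + 1) k : ℤ) * upperCount (n + 1) l =
      (M + 2) * 2 ^ M - 8 * chooseMoment M (n + 1) := by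
  have hterm : ∀ k ∈ range (M + 1), ∀ l ∈ range (M + 1 - k),
      (upperCount (n + 1) k : ℤ) * upperCount (n + 1) l = halfPow k * halfPow l -
        2 * (upperTail (n + 1) k * halfPow l) - 2 * (upperTail (n + 1) l * halfPow k) := by
    intro k hk l hl
    rw [mem_range] at hk hl
    exact upperCount_mul_upperCount (by lia)
  rw [sum_congr rfl fun k hk => sum_congr rfl (hterm k hk)]
  simp only [sum_sub_distrib, ← mul_sum]
  rw [sum_range_triangle_comm (M + 1) fun k l => upperTail (n + 1) l * halfPow k]
  simp only [mul_sum _ _ (upperTail _ _), mul_sum _ _ (halfPow _)]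
  rw [sum_triangle_mul_halfPow, sum_triangle_mul_halfPow, sum_upperTail_mul_pow]
  linear_combination two_mul_sum_halfPow_mul_pow M

lemma sum_upperCount (n : ℕ) :
    ∑ x ∈ range (2 * n + 2) ×ˢ range (2 * n + 2),
      (upperCount (n + 1) (min x.1 (2 * n + 1 - x.2)) : ℤ) *
        upperCount (n + 1) (min x.2 (2 * n + 1 - x.1)) =
      (3 * n + 8) * 4 ^ n - 2 * (3 * n + 2) * (2 * n).choose n := by
  rw [sum_product_min_eq_triangles (2 * n + 1) fun k => (upperCount (n + 1) k : ℤ)]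
  have large := sum_triangle_upperCount (n := n) (M := 2 * n + 1) le_rfl
  have small := sum_triangle_upperCount (n := n) (M := 2 * n) (by lia)
  have moment_succ := chooseMoment_succ (2 * n) n
  have moment := two_mul_chooseMoment (2 * n) (n + 1)
  have tail := two_mul_chooseTail_add_centralBinom n
  have choose_succ : ((n : ℤ) + 1) * (2 * n).choose (n + 1) = n * (2 * n).choose n := by
    have := two_mul_sub_mul_choose (2 * n) n
    push_cast at this
    linear_combination this
  have hpow : (2 : ℤ) ^ (2 * n) = 4 ^ n := by rw [pow_mul]; norm_num
  rw [pow_succ, hpow] at large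
  rw [hpow] at small
  push_cast at large small moment
  refine mul_left_cancel₀ (two_ne_zero (α := ℤ)) ?_
  rw [mul_add, large, small, moment_succ]
  linear_combination (-12) * moment + 8 * tail - 12 * choose_succ

end Evaluation

end TypeB
end

theorem theorem1 (n : ℕ) (hn : 2 ≤ n) :
    {I : LieIdeal ℂ (TypeB.affineBorel n) | TypeB.IsBasicIdeal I}.Finite ∧
    ({I : LieIdeal ℂ (TypeB.affineBorel n) | TypeB.IsBasicIdeal I}.ncard : ℤ) =
      (3 * (n : ℤ) + 5) * 2 ^ (2 * n - 2)
        - 2 * (3 * (n : ℤ) - 1) * ((2 * n - 2).choose (n - 1) : ℤ) := by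
  obtain ⟨m, rfl⟩ : ∃ m, n = m + 1 := ⟨n - 1, by lia⟩
  have hcard := (Set.encard_congr
    (TypeB.bijOn_supportRoots_missingRoots (Nat.succ_pos m)).equiv).trans
    (TypeB.encard_commutingPairs m)
  refine ⟨Set.finite_of_encard_eq_coe hcard, ?_⟩
  rw [Set.ncard, hcard, ENat.toNat_natCast]
  push_cast
  rw [TypeB.sum_upperCount m, show 2 * (m + 1) - 2 = 2 * m by lia, pow_mul]
  ring
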